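/- **Theorem (Representation of the solution by the generalized Green's function).** Let $D\subset\mathbb{R}^n$, $n\ge 1$, be a bounded Lipschitz domain (a bounded open set that is locally the region below the graph of a Lipschitz function; connectedness is not needed), with outward unit normal $n$ and surface measure $ds$ on $\partial D$. Let $$L u=\sum_{k\le p}\ \sum_{j_1,\dots,j_k=1}^{n} a_{j_1\cdots j_k}\,\partial_{j_1}\cdots\partial_{j_k}u$$ be a linear partial differential operator of order (at most) $p$ whose coefficients are smooth on $\overline D$, such that * $L$ is self-adjoint under the homogeneous Dirichlet condition: $\int_D (Lv)\,w=\int_D v\,(Lw)$ for all $v,w\in C^p(\overline D)$ with $v=w=0$ on $\partial D$; * $L$ is interchangeable with the Laplacian: $L\Delta\varphi=\Delta L\varphi$ on $D$ for every smooth $\varphi$. Let $G^t$ be a generalized Green's function of $L$ with excitation $t$ under the Dirichlet condition. That is, for every $\xi\in D$, with all derivatives taken in the first variable $r$: $t(\cdot,\xi)\in L^1_{loc}(D)$; $G^t(\cdot,\xi)\in L^1(D)$ is of class $C^{p+2}$ on $\overline D\setminus\{\xi\}$ and its distributional Laplacian on $D$ is an integrable function; $$\Delta t(\cdot,\xi)=\delta_\xi,\qquad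 L\,G^t(\cdot,\xi)=t(\cdot,\xi)\qquad\text{in the sense of distributions on } D;$$ and $\Delta G^t(\cdot,\xi)=0$ and $G^t(\cdot,\xi)=0$ on $\partial D$. Let $f\in C^2(\overline D)$ and let $u\in C^p(\overline D)$ solve $Lu=f$ in $D$, $u=0$ on $\partial D$. Then: 1. For every $\xi\in D$, the following integrals converge absolutely and $$u(\xi)=\int_D G^t(r,\xi)\,\Delta f(r)\,dr+\int_{\partial D}\Big(f(s)\,\frac{\partial G^t(s,\xi)}{\partial n_s}-G^t(s,\xi)\,\frac{\partial f}{\partial n}(s)\Big)\,ds .$$ 2. If, for a given $\xi\in D$, at every boundary point one of $f,\ \partial G^t(\cdot,\xi)/\partial n$ vanishes and one of $G^t(\cdot,\xi),\ \partial f/\partial n$ vanishes, then $$u(\xi)=\int_D G^t(r,\xi)\,\Delta f(r)\,dr .$$ 3. If $G^t$ is symmetric, $G^t(r,\xi)=G^t(\xi,r)$ for $r\in D$, $\xi\in\overline D$, then for every $r\in D$ $$u(r)=\int_D G^t(r,\xi)\,\Delta f(\xi)\,d\xi+\int_{\partial D}\Big(f(s)\,\frac{\partial G^t(r,s)}{\partial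 n_s}-G^t(r,s)\,\frac{\partial f}{\partial n}(s)\Big)\,ds ,$$ again with absolutely convergent integrals, and if at every boundary point one of $f,\ \partial G^t(r,\cdot)/\partial n$ and one of $G^t(r,\cdot),\ \partial f/\partial n$ vanish, then $u(r)=\int_D G^t(r,\xi)\,\Delta f(\xi)\,d\xi$. -/

import Mathlib

open MeasureTheory Filter Topology
open scoped NNReal ContDiff Laplacian InnerProductSpace

/-- A bounded Lipschitz domain in `ℝⁿ`: a bounded open set which, near each of its boundary points,
is the region lying strictly below the graph of a Lipschitz function over a hyperplane `e^⊥`. The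
unit vector `e` points out of the set; `y - ⟪e, y⟫ • e` is the orthogonal projection of `y` to the
hyperplane. -/
structure IsBoundedLipschitzDomain {n : ℕ} (D : Set (EuclideanSpace ℝ (Fin n))) : Prop where
  isOpen : IsOpen D
  isBounded : Bornology.IsBounded D
  locally_subgraph : ∀ x ∈ frontier D,
    ∃ (e : EuclideanSpace ℝ (Fin n)) (K : ℝ≥0) (γ : EuclideanSpace ℝ (Fin n) → ℝ)
      (U : Set (EuclideanSpace ℝ (Fin n))),
      ‖e‖ = 1 ∧ LipschitzWith K γ ∧ IsOpen U ∧ x ∈ U ∧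
      ∀ y ∈ U, (y ∈ D ↔ inner ℝ e y < γ (y - (inner ℝ e y : ℝ) • e))

/-- `ν` is the outward unit normal of `D` at `x`: near `x`, every cone around `-ν` of opening less
than a half-space is inside `D`, and every such cone around `ν` is outside `D`. -/
def IsOutwardUnitNormal {n : ℕ} (D : Set (EuclideanSpace ℝ (Fin n)))
    (x ν : EuclideanSpace ℝ (Fin n)) : Prop :=
  ‖ν‖ = 1 ∧ ∀ ε : ℝ, 0 < ε → ∀ᶠ y in 𝓝 x,
    (inner ℝ (y - x) ν < -(ε * ‖y - x‖) → y ∈ D) ∧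
    (ε * ‖y - x‖ < inner ℝ (y - x) ν → y ∉ D)

open Classical in
/-- The outward unit normal field. It is unique where it exists, and for a Lipschitz domain it
exists at almost every boundary point; elsewhere the value is `0`. -/
noncomputable def outwardNormal {n : ℕ} (D : Set (EuclideanSpace ℝ (Fin n)))
    (x : EuclideanSpace ℝ (Fin n)) : EuclideanSpace ℝ (Fin n) :=
  if h : ∃ ν, IsOutwardUnitNormal D x ν then h.choose else 0

/-- The outward normal derivative `∂g/∂n` at a boundary point of `D`, for `g` on the closure. -/
noncomputable def normalDeriv {n : ℕ} (D : Set (EuclideanSpace ℝ (Fin n)))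
    (g : EuclideanSpace ℝ (Fin n) → ℝ) (x : EuclideanSpace ℝ (Fin n)) : ℝ :=
  fderivWithin ℝ g (closure D) x (outwardNormal D x)

/-- The surface measure of `∂D`: the `(n-1)`-dimensional Hausdorff measure on `∂D`, in the
normalization which agrees with Lebesgue measure on `ℝⁿ⁻¹`. -/
noncomputable def surfaceMeasure {n : ℕ} (D : Set (EuclideanSpace ℝ (Fin n))) :
    Measure (EuclideanSpace ℝ (Fin n)) :=
  (μHE[n - 1] : Measure (EuclideanSpace ℝ (Fin n))).restrict (frontier D)

/-- A test function on `D`: smooth, with compact support contained in `D`. -/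
structure IsTestFunction {n : ℕ} (D : Set (EuclideanSpace ℝ (Fin n)))
    (φ : EuclideanSpace ℝ (Fin n) → ℝ) : Prop where
  contDiff : ContDiff ℝ ∞ φ
  hasCompactSupport : HasCompactSupport φ
  tsupport_subset : tsupport φ ⊆ D

/-- The iterated partial derivative `∂_{J 0} ⋯ ∂_{J (k-1)} u`. -/
noncomputable def partialDeriv {n k : ℕ} (J : Fin k → Fin n)
    (u : EuclideanSpace ℝ (Fin n) → ℝ) (x : EuclideanSpace ℝ (Fin n)) : ℝ :=
  iteratedFDeriv ℝ k u x (fun i => EuclideanSpace.single (J i) (1 : ℝ))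

/-- A linear partial differential operator on `D` of order (at most) `p`, with coefficients that
are smooth up to the boundary. Only the coefficients `coeff k` with `k ≤ p` matter. -/
structure LinearPDO {n : ℕ} (D : Set (EuclideanSpace ℝ (Fin n))) (p : ℕ) where
  coeff : (k : ℕ) → (Fin k → Fin n) → EuclideanSpace ℝ (Fin n) → ℝ
  smooth : ∀ k ≤ p, ∀ J : Fin k → Fin n, ContDiffOn ℝ ∞ (coeff k J) (closure D)

namespace LinearPDO

variable {n p : ℕ} {D : Set (EuclideanSpace ℝ (Fin n))}

/-- `L u = ∑_{k ≤ p} ∑_J a_{k,J} ∂_J u` (meaningful at the points of `D`). -/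
noncomputable def apply (L : LinearPDO D p) (u : EuclideanSpace ℝ (Fin n) → ℝ)
    (x : EuclideanSpace ℝ (Fin n)) : ℝ :=
  ∑ k ∈ Finset.range (p + 1), ∑ J : Fin k → Fin n, L.coeff k J x * partialDeriv J u x

/-- The formal transpose `∑_{k ≤ p} ∑_J (-1)^k ∂_J (a_{k,J} φ)`. -/
noncomputable def transpose (L : LinearPDO D p) (φ : EuclideanSpace ℝ (Fin n) → ℝ)
    (x : EuclideanSpace ℝ (Fin n)) : ℝ :=
  ∑ k ∈ Finset.range (p + 1), ∑ J : Fin k → Fin n,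
    (-1 : ℝ) ^ k * partialDeriv J (fun y => L.coeff k J y * φ y) x

/-- `L` is self-adjoint under the Dirichlet condition: it is symmetric in `L²(D)` on the functions
of class `C^p` up to the boundary that vanish on `∂D`. -/
def IsSelfAdjoint (L : LinearPDO D p) : Prop :=
  ∀ v w : EuclideanSpace ℝ (Fin n) → ℝ,
    ContDiffOn ℝ p v (closure D) → ContDiffOn ℝ p w (closure D) →
    (∀ x ∈ frontier D, v x = 0) → (∀ x ∈ frontier D, w x = 0) →
    ∫ x in D, L.apply v x * w x = ∫ x in D, v x * L.apply w x

/-- `L Δ φ = Δ L φ` on `D` for smooth `φ`. -/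
def CommutesWithLaplacian (L : LinearPDO D p) : Prop :=
  ∀ φ : EuclideanSpace ℝ (Fin n) → ℝ, ContDiff ℝ ∞ φ →
    ∀ x ∈ D, L.apply (Δ φ) x = Δ (L.apply φ) x

/-- `u` is a (classical) solution of `L u = f` in `D`, `u = 0` on `∂D`. -/
structure IsDirichletSolution (L : LinearPDO D p) (f u : EuclideanSpace ℝ (Fin n) → ℝ) :
    Prop where
  contDiffOn : ContDiffOn ℝ p u (closure D)
  equation : ∀ x ∈ D, L.apply u x = f x
  boundary : ∀ x ∈ frontier D, u x = 0

/-- `G` is a generalized Green's function of `L` (under the Dirichlet condition) with excitation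
`t`: for each source point `ξ ∈ D`, with all derivatives taken in the first variable,
`Δ t(·, ξ) = δ_ξ` and `L G(·, ξ) = t(·, ξ)` in the sense of distributions on `D`, and
`Δ G(·, ξ) = 0` and `G(·, ξ) = 0` on `∂D`. Here `G(·, ξ)` is regular up to the boundary away
from `ξ`, and its distributional Laplacian is an integrable function. -/
structure IsGeneralizedGreen (L : LinearPDO D p)
    (t G : EuclideanSpace ℝ (Fin n) → EuclideanSpace ℝ (Fin n) → ℝ) : Prop where
  t_locallyIntegrable : ∀ ξ ∈ D, LocallyIntegrableOn (fun r => t r ξ) D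
  laplacian_t : ∀ ξ ∈ D, ∀ φ : EuclideanSpace ℝ (Fin n) → ℝ, IsTestFunction D φ →
    ∫ r in D, t r ξ * Δ φ r = φ ξ
  contDiffOn : ∀ ξ ∈ D, ContDiffOn ℝ ((p + 2 : ℕ) : WithTop ℕ∞) (fun r => G r ξ) (closure D \ {ξ})
  integrableOn : ∀ ξ ∈ D, IntegrableOn (fun r => G r ξ) D
  laplacian_integrableOn : ∀ ξ ∈ D, IntegrableOn (Δ (fun r => G r ξ)) D
  weak_laplacian : ∀ ξ ∈ D, ∀ φ : EuclideanSpace ℝ (Fin n) → ℝ, IsTestFunction D φ →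
    ∫ r in D, G r ξ * Δ φ r = ∫ r in D, Δ (fun r => G r ξ) r * φ r
  equation : ∀ ξ ∈ D, ∀ φ : EuclideanSpace ℝ (Fin n) → ℝ, IsTestFunction D φ →
    ∫ r in D, G r ξ * L.transpose φ r = ∫ r in D, t r ξ * φ r
  laplacian_boundary : ∀ ξ ∈ D, ∀ r ∈ frontier D, (Δ[closure D] (fun r => G r ξ)) r = 0
  boundary : ∀ ξ ∈ D, ∀ r ∈ frontier D, G r ξ = 0

end LinearPDO

/-!
Write `W = Δ G(·, ξ)`. Since `L` is self-adjoint it is its own formal transpose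
(`IsSelfAdjoint.transpose_eq`), and since it commutes with the Laplacian,
`L W = Δ L G(·, ξ) = Δ t(·, ξ) = δ_ξ` in the sense of distributions
(`IsGeneralizedGreen.integral_laplacian_mul_apply`). So `W`, which vanishes on the boundary by
assumption, is an ordinary Green's function of `L`, and `u(ξ) = ∫ W f`
(`IsGeneralizedGreen.setIntegral_laplacian_mul`). To see the last identity, split `u` with a cutoff
function at `ξ`. The part near `ξ` has compact support in `D`, and there `L W = δ_ξ` may be used; as
this part is only of class `C^p`, the distributional identity is first extended from test functions
by mollification (`exists_testFunction_close`). The part away from `ξ` is paired with a modification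
of `W` that is regular up to the boundary, and self-adjointness under the Dirichlet condition moves
`L` onto `W`, which it annihilates. Green's second identity (`IsGeneralizedGreen.green`) then turns
`∫ W f` into `∫ G Δf` plus the boundary terms; `ξ` does not contribute, because the distributional
Laplacian of `G(·, ξ)` is an integrable function. For a symmetric kernel the arguments may be
exchanged, also in the normal derivative, as the symmetry holds up to the boundary.

Green's identity rests on the divergence theorem on a bounded Lipschitz domain
(`IsBoundedLipschitzDomain.gauss`). A partition of unity reduces it to functions supported in one
chart, where the domain is the region below a Lipschitz graph. In coordinates that shear the graph
to a hyperplane, the derivative splits into a part tangential to the translates of the graph, whose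
integral over each translate vanishes, and a part in the direction of `e`, to which the fundamental
theorem of calculus applies (`setIntegral_subgraph_fderiv`). The resulting integral over the
hyperplane is the surface integral over the graph: by Rademacher's theorem `γ` is differentiable
almost everywhere, where the outward normal is the normalized vector `e - ∇γ`
(`isOutwardUnitNormal_graphMap`), and the Hausdorff measure on the graph has density
`√(1 + |∇γ|²)` (`comap_graphMap_euclideanHausdorffMeasure`), which is a case of the area formula for
bi-Lipschitz embeddings (`comap_euclideanHausdorffMeasure_eq_withDensity`).
-/

/-! ### The area formula for bi-Lipschitz embeddings -/

/-- If distances under `g` are at most `C` times those under `h`, then so is the Hausdorff measure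
of the image, up to the power `C ^ d`; neither map need be injective. -/
lemma euclideanHausdorffMeasure_image_le_of_dist_le {X Y Z : Type*} [Nonempty X]
    [MetricSpace Y] [MeasurableSpace Y] [BorelSpace Y]
    [MetricSpace Z] [MeasurableSpace Z] [BorelSpace Z]
    {g : X → Y} {h : X → Z} {t : Set X} {C : ℝ≥0} (d : ℕ)
    (hgh : ∀ x ∈ t, ∀ y ∈ t, dist (g x) (g y) ≤ C * dist (h x) (h y)) :
    (μHE[d] : Measure Y) (g '' t) ≤ (C : ENNReal) ^ d * (μHE[d] : Measure Z) (h '' t) := by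
  set k : Z → Y := g ∘ Function.invFunOn h t with hk
  have hmem : ∀ x ∈ t, Function.invFunOn h t (h x) ∈ t ∧
      h (Function.invFunOn h t (h x)) = h x := fun x hx =>
    Function.invFunOn_pos ⟨x, hx, rfl⟩
  have hkh : ∀ x ∈ t, k (h x) = g x := by
    intro x hx
    have h1 := hgh _ (hmem x hx).1 x hx
    rw [(hmem x hx).2, dist_self, mul_zero] at h1
    exact dist_le_zero.1 h1
  have himg : g '' t = k '' (h '' t) := by
    rw [Set.image_image]
    exact Set.image_congr fun x hx => (hkh x hx).symm
  have hlip : LipschitzOnWith C k (h '' t) := by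
    refine LipschitzOnWith.of_dist_le_mul ?_
    rintro _ ⟨x, hx, rfl⟩ _ ⟨y, hy, rfl⟩
    rw [hkh x hx, hkh y hy]
    exact hgh x hx y hy
  have h2 := hlip.hausdorffMeasure_image_le (d := (d : ℝ)) (by positivity)
  rw [himg]
  simp only [Measure.euclideanHausdorffMeasure_def, Measure.smul_apply,
    Measure.nnreal_smul_coe_apply]
  rw [mul_left_comm]
  gcongr
  simpa using h2

section AreaFormula

variable {V E : Type*} [NormedAddCommGroup V] [InnerProductSpace ℝ V] [FiniteDimensional ℝ V]
  [MeasurableSpace V] [BorelSpace V]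
  [NormedAddCommGroup E] [InnerProductSpace ℝ E] [FiniteDimensional ℝ E]
  [MeasurableSpace E] [BorelSpace E]

set_option linter.unusedSectionVars false

/-- The derivative inherits the antilipschitz constant. -/
lemma le_mul_norm_of_hasFDerivAt_of_antilipschitzWith {f : V → E} {A : V →L[ℝ] E} {x : V} {K : ℝ≥0}
    (hf : AntilipschitzWith K f) (h : HasFDerivAt f A x) (z : V) : ‖z‖ ≤ K * ‖A z‖ := by
  have h1 : Tendsto (fun c : ℝ => ‖c • (f (x + c⁻¹ • z) - f x)‖) atTop (𝓝 ‖A z‖) :=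
    (h.lim_real z).norm
  refine ge_of_tendsto (h1.const_mul (K : ℝ)) ?_
  filter_upwards [eventually_gt_atTop 0] with c hc
  have h2 := hf.le_mul_dist (x + c⁻¹ • z) x
  rw [dist_eq_norm, dist_eq_norm, add_sub_cancel_left, norm_smul, norm_inv, Real.norm_eq_abs,
    abs_of_pos hc] at h2
  rw [norm_smul, Real.norm_eq_abs, abs_of_pos hc]
  calc ‖z‖ = c * (c⁻¹ * ‖z‖) := by field_simp
    _ ≤ c * (K * ‖f (x + c⁻¹ • z) - f x‖) := by gcongr
    _ = _ := by ring

/-- If `f - g` is `δ`-Lipschitz and `g` is antilipschitz, the measure of the image under `f` is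
controlled by that under `g`, with a factor tending to `1` with `δ`. -/
lemma image_measure_le_of_close {f g : V → E} {t : Set V} {K δ : ℝ≥0} (d : ℕ)
    (hg : ∀ x ∈ t, ∀ y ∈ t, dist x y ≤ K * dist (g x) (g y))
    (hfg : ∀ x ∈ t, ∀ y ∈ t, ‖(f x - f y) - (g x - g y)‖ ≤ δ * ‖x - y‖) :
    (μHE[d] : Measure E) (f '' t) ≤
      ((1 + δ * K : ℝ≥0) : ENNReal) ^ d * (μHE[d] : Measure E) (g '' t) := by
  refine euclideanHausdorffMeasure_image_le_of_dist_le d fun x hx y hy => ?_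
  have h1 := hg x hx y hy
  have h2 := hfg x hx y hy
  rw [dist_eq_norm] at h1 ⊢
  rw [dist_eq_norm] at h1 ⊢
  have h3 : ‖f x - f y‖ ≤ ‖g x - g y‖ + ‖(f x - f y) - (g x - g y)‖ := by
    have := norm_add_le (g x - g y) ((f x - f y) - (g x - g y))
    simpa using this
  push_cast
  have h4 : (δ : ℝ) * ‖x - y‖ ≤ δ * (K * ‖g x - g y‖) := by gcongr
  linarith

/-- Comparison of `normDet` for two linear maps that are close to each other, read off from the
measures of the images of the unit ball. -/
lemma normDet_le_of_close {A B : V →L[ℝ] E} {K δ : ℝ≥0} (hB : ∀ z, ‖z‖ ≤ K * ‖B z‖)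
    (hAB : ‖A - B‖ ≤ δ) :
    ENNReal.ofReal (A : V →ₗ[ℝ] E).normDet ≤
      ((1 + δ * K : ℝ≥0) : ENNReal) ^ (Module.finrank ℝ V) *
        ENNReal.ofReal (B : V →ₗ[ℝ] E).normDet := by
  have h := image_measure_le_of_close (f := A) (g := B) (t := Metric.ball 0 1) (K := K) (δ := δ)
    (Module.finrank ℝ V)
    (fun x _ y _ => by
      rw [dist_eq_norm, dist_eq_norm, ← map_sub]; exact hB _)
    (fun x _ y _ => by
      rw [← map_sub, ← map_sub, ← sub_apply]
      exact (A - B).le_of_opNorm_le hAB _)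
  have hA := (A : V →ₗ[ℝ] E).euclideanHausdorffMeasure_image_eq_normDet_mul_volume
    (Metric.ball 0 1)
  have hB' := (B : V →ₗ[ℝ] E).euclideanHausdorffMeasure_image_eq_normDet_mul_volume
    (Metric.ball 0 1)
  simp only [ContinuousLinearMap.coe_coe] at hA hB'
  rw [hA, hB', ← mul_assoc] at h
  have hpos : volume (Metric.ball (0 : V) 1) ≠ 0 := (Metric.measure_ball_pos _ _ one_pos).ne'
  have hfin : volume (Metric.ball (0 : V) 1) ≠ ⊤ := measure_ball_lt_top.ne
  exact (ENNReal.mul_le_mul_iff_left hpos hfin).1 h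

/-- A countable measurable partition of the set of points of differentiability, on each piece of
which `f` is close to a linear map and its derivative is close to the same linear map. -/
lemma exists_partition_close_to_linear {f : V → E} {K : ℝ≥0} (hf : AntilipschitzWith K f)
    {δ : ℝ≥0} (hδ : 0 < δ) :
    ∃ (t : ℕ → Set V), (∀ n, MeasurableSet (t n)) ∧ Pairwise (Function.onFun Disjoint t) ∧
      (⋃ n, t n) = {x | DifferentiableAt ℝ f x} ∧
      ∀ n, t n = ∅ ∨ ∃ A : V →L[ℝ] E, (∀ z, ‖z‖ ≤ K * ‖A z‖) ∧ ApproximatesLinearOn f A (t n) δ ∧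
        ∀ x ∈ t n, ‖fderiv ℝ f x - A‖ ≤ δ := by
  classical
  have hDm : MeasurableSet {x | DifferentiableAt ℝ f x} := measurableSet_of_differentiableAt ℝ f
  -- pieces on which the derivative varies by less than `δ`
  set s : ℕ → Set V := fun k => {x | DifferentiableAt ℝ f x} ∩
    fderiv ℝ f ⁻¹' Metric.ball (TopologicalSpace.denseSeq (V →L[ℝ] E) k) (δ / 2) with hs
  have hsm : ∀ k, MeasurableSet (s k) := fun k =>
    hDm.inter (measurable_fderiv ℝ f Metric.isOpen_ball.measurableSet)
  have hsU : ⋃ k, s k = {x | DifferentiableAt ℝ f x} := by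
    refine Set.Subset.antisymm (Set.iUnion_subset fun k => Set.inter_subset_left) fun x hx => ?_
    obtain ⟨k, hk⟩ := (TopologicalSpace.denseRange_denseSeq (V →L[ℝ] E)).exists_dist_lt
      (fderiv ℝ f x) (ε := δ / 2) (by positivity)
    exact Set.mem_iUnion.2 ⟨k, hx, hk⟩
  have hpart : ∀ k, ∃ (t : ℕ → Set V) (A : ℕ → V →L[ℝ] E), (∀ n, MeasurableSet (t n)) ∧
      s k ⊆ ⋃ n, t n ∧ (∀ n, ApproximatesLinearOn f (A n) (s k ∩ t n) δ) ∧
      ((s k).Nonempty → ∀ n, ∃ y ∈ s k, A n = fderiv ℝ f y) := by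
    intro k
    obtain ⟨t, A, -, h2, h3, h4, h5⟩ := exists_partition_approximatesLinearOn_of_hasFDerivWithinAt
      f (s k) (fderiv ℝ f) (fun x hx => hx.1.hasFDerivAt.hasFDerivWithinAt) (fun _ => δ)
      (fun _ => hδ.ne')
    exact ⟨t, A, h2, h3, h4, h5⟩
  choose t A htm htU htA htd using hpart
  set q : ℕ → Set V := fun m => s (Nat.unpair m).1 ∩ t (Nat.unpair m).1 (Nat.unpair m).2 with hq
  have hqm : ∀ m, MeasurableSet (q m) := fun m => (hsm _).inter (htm _ _)
  have hqU : ⋃ m, q m = {x | DifferentiableAt ℝ f x} := by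
    rw [← hsU]
    refine Set.Subset.antisymm (Set.iUnion_subset fun m => ?_) (Set.iUnion_subset fun k x hx => ?_)
    · exact Set.inter_subset_left.trans (Set.subset_iUnion s _)
    · obtain ⟨n, hn⟩ := Set.mem_iUnion.1 (htU k hx)
      refine Set.mem_iUnion.2 ⟨Nat.pair k n, ?_⟩
      simp only [hq, Nat.unpair_pair]
      exact ⟨hx, hn⟩
  refine ⟨disjointed q, fun n => MeasurableSet.disjointed hqm n, disjoint_disjointed q,
    (iUnion_disjointed).trans hqU, fun m => ?_⟩
  have hsub : disjointed q m ⊆ q m := disjointed_subset q m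
  rcases (q m).eq_empty_or_nonempty with hem | ⟨x0, hx0⟩
  · exact Or.inl (Set.subset_eq_empty hsub hem)
  · obtain ⟨y, hy, hAy⟩ := htd _ ⟨x0, hx0.1⟩ (Nat.unpair m).2
    refine Or.inr ⟨A (Nat.unpair m).1 (Nat.unpair m).2, ?_, (htA _ _).mono_set hsub, fun x hx => ?_⟩
    · rw [hAy]
      exact le_mul_norm_of_hasFDerivAt_of_antilipschitzWith hf hy.1.hasFDerivAt
    · rw [hAy, ← dist_eq_norm]
      have h1 := (hsub hx).1.2
      have h2 := hy.2
      rw [Set.mem_preimage, Metric.mem_ball] at h1 h2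
      have := dist_triangle_right (fderiv ℝ f x) (fderiv ℝ f y)
        (TopologicalSpace.denseSeq (V →L[ℝ] E) (Nat.unpair m).1)
      linarith

/-- The area formula: a bi-Lipschitz embedding pulls the Hausdorff measure of the dimension of its
source back to the Jacobian density. The proof compares both sides on countably many pieces on which
the map is nearly linear, where they agree up to a factor arbitrarily close to `1`. -/
theorem comap_euclideanHausdorffMeasure_eq_withDensity {f : V → E} {C K : ℝ≥0}
    (hfC : LipschitzWith C f) (hfK : AntilipschitzWith K f) :
    (μHE[Module.finrank ℝ V] : Measure E).comap f =
      volume.withDensity fun x => ENNReal.ofReal (fderiv ℝ f x : V →ₗ[ℝ] E).normDet := by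
  set d := Module.finrank ℝ V with hd
  have hemb : MeasurableEmbedding f :=
    (hfK.isClosedEmbedding hfC.uniformContinuous).measurableEmbedding
  set J : V → ENNReal := fun x => ENNReal.ofReal (fderiv ℝ f x : V →ₗ[ℝ] E).normDet with hJ
  set D : Set V := {x | DifferentiableAt ℝ f x} with hD
  have hDm : MeasurableSet D := measurableSet_of_differentiableAt ℝ f
  have hDn : volume Dᶜ = 0 := hfC.ae_differentiableAt (μ := (volume : Measure V))
  have hDn' : (μHE[d] : Measure E).comap f Dᶜ = 0 := by
    rw [hemb.comap_apply]
    have h := euclideanHausdorffMeasure_image_le_of_dist_le (g := f) (h := (id : V → V))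
      (t := Dᶜ) (C := C) d (fun x _ y _ => hfC.dist_le_mul x y)
    rw [Set.image_id, InnerProductSpace.euclideanHausdorffMeasure_eq_volume, hDn, mul_zero] at h
    exact le_antisymm h bot_le
  -- the two measures agree up to the factor `(1 + δ K) ^ (2 d)`
  have key : ∀ δ : ℝ≥0, 0 < δ → ∀ S, MeasurableSet S →
      (μHE[d] : Measure E).comap f S ≤
        (((1 + δ * K : ℝ≥0) : ENNReal) ^ d * ((1 + δ * K : ℝ≥0) : ENNReal) ^ d) *
          volume.withDensity J S ∧
      volume.withDensity J S ≤
        (((1 + δ * K : ℝ≥0) : ENNReal) ^ d * ((1 + δ * K : ℝ≥0) : ENNReal) ^ d) *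
          (μHE[d] : Measure E).comap f S := by
    intro δ hδ S hS
    set q : ENNReal := ((1 + δ * K : ℝ≥0) : ENNReal) ^ d with hq
    obtain ⟨t, htm, htd, htU, htA⟩ := exists_partition_close_to_linear hfK hδ
    -- both measures are carried by the points of differentiability, hence by the pieces `t n`
    have hdec : ∀ m : Measure V, m Dᶜ = 0 → m S = ∑' n, m (S ∩ t n) := by
      intro m hm
      rw [← measure_iUnion (fun i j hij => (htd hij).mono Set.inter_subset_right
        Set.inter_subset_right) (fun n => hS.inter (htm n)), ← Set.inter_iUnion, htU]
      rw [← measure_inter_add_sdiff S hDm]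
      have : m (S \ D) = 0 := measure_mono_null (fun x hx => hx.2) hm
      rw [this, add_zero]
    have h1 := hdec _ hDn'
    have h2 := hdec (volume.withDensity J) (withDensity_absolutelyContinuous _ _ hDn)
    have hpiece : ∀ n, (μHE[d] : Measure E).comap f (S ∩ t n) ≤
          (q * q) * volume.withDensity J (S ∩ t n) ∧
        volume.withDensity J (S ∩ t n) ≤ (q * q) * (μHE[d] : Measure E).comap f (S ∩ t n) := by
      intro n
      rcases htA n with he | ⟨A, hA, hfA, hfd⟩
      · simp [he]
      rw [hemb.comap_apply, withDensity_apply _ (hS.inter (htm n))]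
      have hlin : (μHE[d] : Measure E) (A '' (S ∩ t n)) =
          ENNReal.ofReal (A : V →ₗ[ℝ] E).normDet * volume (S ∩ t n) := by
        simpa using (A : V →ₗ[ℝ] E).euclideanHausdorffMeasure_image_eq_normDet_mul_volume (S ∩ t n)
      have hclose : ∀ x ∈ S ∩ t n, ∀ y ∈ S ∩ t n,
          ‖(f x - f y) - (A x - A y)‖ ≤ δ * ‖x - y‖ := by
        intro x hx y hy
        rw [← map_sub]
        exact hfA x hx.2 y hy.2
      have h3 := image_measure_le_of_close (K := K) d (fun x (_ : x ∈ S ∩ t n) y _ => by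
        rw [dist_eq_norm, dist_eq_norm, ← map_sub]; exact hA _) hclose
      have h4 := image_measure_le_of_close (K := K) d
        (fun x (_ : x ∈ S ∩ t n) y _ => hfK.le_mul_dist x y)
        (fun x hx y hy => by rw [norm_sub_rev]; exact hclose x hx y hy)
      rw [hlin] at h3 h4
      have hAJ : ∀ x ∈ S ∩ t n, ENNReal.ofReal (A : V →ₗ[ℝ] E).normDet ≤ q * J x := by
        intro x hx
        have hx' : DifferentiableAt ℝ f x := by
          have : x ∈ ⋃ n, t n := Set.mem_iUnion.2 ⟨n, hx.2⟩
          rwa [htU] at this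
        refine normDet_le_of_close
          (le_mul_norm_of_hasFDerivAt_of_antilipschitzWith hfK hx'.hasFDerivAt) ?_
        rw [norm_sub_rev]
        exact hfd x hx.2
      have hJA : ∀ x ∈ S ∩ t n, J x ≤ q * ENNReal.ofReal (A : V →ₗ[ℝ] E).normDet :=
        fun x hx => normDet_le_of_close hA (hfd x hx.2)
      have hqt : q ≠ ⊤ := ENNReal.pow_ne_top ENNReal.coe_ne_top
      constructor
      · refine h3.trans ?_
        rw [mul_assoc]
        refine mul_le_mul_right ?_ q
        rw [← lintegral_const_mul' _ _ hqt, ← setLIntegral_const]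
        exact setLIntegral_mono' (hS.inter (htm n)) hAJ
      · calc ∫⁻ x in S ∩ t n, J x ≤ ∫⁻ _ in S ∩ t n, q * ENNReal.ofReal
              (A : V →ₗ[ℝ] E).normDet := setLIntegral_mono' (hS.inter (htm n)) hJA
          _ = q * (ENNReal.ofReal (A : V →ₗ[ℝ] E).normDet * volume (S ∩ t n)) := by
            rw [setLIntegral_const, mul_assoc]
          _ ≤ _ := by rw [mul_assoc]; gcongr
    rw [h1, h2, ← ENNReal.tsum_mul_left, ← ENNReal.tsum_mul_left]
    exact ⟨ENNReal.tsum_le_tsum fun n => (hpiece n).1, ENNReal.tsum_le_tsum fun n => (hpiece n).2⟩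
  have hlim : ∀ c : ENNReal, Tendsto (fun δ : ℝ≥0 => (((1 + δ * K : ℝ≥0) : ENNReal) ^ d *
      ((1 + δ * K : ℝ≥0) : ENNReal) ^ d) * c) (𝓝[>] 0) (𝓝 c) := by
    intro c
    have h1 : Tendsto (fun δ : ℝ≥0 => ((((1 + δ * K) ^ d * (1 + δ * K) ^ d : ℝ≥0)) : ENNReal))
        (𝓝[>] 0) (𝓝 ((1 : ℝ≥0) : ENNReal)) := by
      refine ENNReal.tendsto_coe.2 (Tendsto.mono_left ?_ nhdsWithin_le_nhds)
      have : Continuous fun δ : ℝ≥0 => (1 + δ * K) ^ d * (1 + δ * K) ^ d := by fun_prop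
      simpa using this.tendsto 0
    have h2 := ENNReal.Tendsto.mul_const (b := c) h1 (Or.inl (by simp))
    simpa using h2
  refine Measure.ext fun S hS => le_antisymm ?_ ?_
  · refine ge_of_tendsto (hlim _) ?_
    filter_upwards [self_mem_nhdsWithin] with δ hδ
    exact (key δ hδ S hS).1
  · refine ge_of_tendsto (hlim _) ?_
    filter_upwards [self_mem_nhdsWithin] with δ hδ
    exact (key δ hδ S hS).2

end AreaFormula

/-! ### Graphs of Lipschitz functions over a hyperplane -/

section Graph

variable {E : Type*} [NormedAddCommGroup E] [InnerProductSpace ℝ E]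

/-- The parametrization `x ↦ x + γ(x) e` of the graph of `γ` over the hyperplane `e^⊥`. -/
def graphMap (e : E) (γ : E → ℝ) (x : (ℝ ∙ e)ᗮ) : E := (x : E) + γ x • e

/-- The function `γ` restricted to the hyperplane `e^⊥`. -/
def restrictPerp (e : E) (γ : E → ℝ) (x : (ℝ ∙ e)ᗮ) : ℝ := γ x

/-- The open region strictly below the graph of `γ` over `e^⊥`. -/
def subgraph (e : E) (γ : E → ℝ) : Set E :=
  {y | inner ℝ e y < γ (y - (inner ℝ e y : ℝ) • e)}

/-- The closed region below the graph of `γ` over `e^⊥`. -/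
def closedSubgraph (e : E) (γ : E → ℝ) : Set E :=
  {y | inner ℝ e y ≤ γ (y - (inner ℝ e y : ℝ) • e)}

variable {e : E} {γ : E → ℝ} {K : ℝ≥0}

set_option linter.unusedSectionVars false

lemma inner_perp_eq_zero (x : (ℝ ∙ e)ᗮ) : inner ℝ e (x : E) = 0 :=
  Submodule.mem_orthogonal_singleton_iff_inner_right.1 x.2

lemma inner_perp_add_smul (he : ‖e‖ = 1) (x : (ℝ ∙ e)ᗮ) (s : ℝ) :
    inner ℝ e ((x : E) + s • e) = s := by
  rw [inner_add_right, inner_perp_eq_zero, inner_smul_right, real_inner_self_eq_norm_sq, he]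
  ring

lemma perp_add_smul_sub (he : ‖e‖ = 1) (x : (ℝ ∙ e)ᗮ) (s : ℝ) :
    ((x : E) + s • e) - (inner ℝ e ((x : E) + s • e) : ℝ) • e = x := by
  rw [inner_perp_add_smul he, add_sub_cancel_right]

lemma perp_add_smul_mem_subgraph (he : ‖e‖ = 1) (x : (ℝ ∙ e)ᗮ) (s : ℝ) :
    (x : E) + s • e ∈ subgraph e γ ↔ s < γ x := by
  rw [subgraph, Set.mem_ofPred_eq, perp_add_smul_sub he, inner_perp_add_smul he]

lemma perp_add_smul_mem_closedSubgraph (he : ‖e‖ = 1) (x : (ℝ ∙ e)ᗮ) (s : ℝ) :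
    (x : E) + s • e ∈ closedSubgraph e γ ↔ s ≤ γ x := by
  rw [closedSubgraph, Set.mem_ofPred_eq, perp_add_smul_sub he, inner_perp_add_smul he]

lemma sub_inner_smul_mem_perp (he : ‖e‖ = 1) (y : E) :
    y - (inner ℝ e y : ℝ) • e ∈ (ℝ ∙ e)ᗮ := by
  rw [Submodule.mem_orthogonal_singleton_iff_inner_right, inner_sub_right, inner_smul_right,
    real_inner_self_eq_norm_sq, he]
  ring

/-- The orthogonal projection to `e^⊥`. -/
def perpPart (he : ‖e‖ = 1) (y : E) : (ℝ ∙ e)ᗮ := ⟨_, sub_inner_smul_mem_perp he y⟩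

lemma perpPart_add_smul (he : ‖e‖ = 1) (y : E) :
    (perpPart he y : E) + (inner ℝ e y : ℝ) • e = y := by
  simp [perpPart]

lemma norm_perp_add_smul_sq (he : ‖e‖ = 1) (x : (ℝ ∙ e)ᗮ) (s : ℝ) :
    ‖(x : E) + s • e‖ ^ 2 = ‖x‖ ^ 2 + s ^ 2 := by
  rw [norm_add_sq_real, inner_smul_right, real_inner_comm, inner_perp_eq_zero, norm_smul, he]
  simp

lemma norm_le_norm_perp_add_smul (he : ‖e‖ = 1) (x : (ℝ ∙ e)ᗮ) (s : ℝ) :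
    ‖x‖ ≤ ‖(x : E) + s • e‖ := by
  refine le_of_sq_le_sq ?_ (norm_nonneg _)
  rw [norm_perp_add_smul_sq he]
  nlinarith [sq_nonneg s]

lemma graphMap_sub (x y : (ℝ ∙ e)ᗮ) :
    graphMap e γ x - graphMap e γ y = ((x - y : (ℝ ∙ e)ᗮ) : E) + (γ x - γ y) • e := by
  simp only [graphMap, sub_smul, Submodule.coe_sub]
  abel

lemma restrictPerp_lipschitzWith (hγ : LipschitzWith K γ) :
    LipschitzWith K (restrictPerp e γ) :=
  LipschitzWith.of_dist_le_mul fun x y => hγ.dist_le_mul x y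

lemma graphMap_lipschitzWith (he : ‖e‖ = 1) (hγ : LipschitzWith K γ) :
    LipschitzWith (1 + K) (graphMap e γ) := by
  refine LipschitzWith.of_dist_le_mul fun x y => ?_
  rw [dist_eq_norm, dist_eq_norm, graphMap_sub]
  refine (norm_add_le _ _).trans ?_
  have h := hγ.dist_le_mul x y
  rw [dist_eq_norm, dist_eq_norm, ← Submodule.coe_sub, Submodule.norm_coe] at h
  rw [norm_smul, he, mul_one, Submodule.norm_coe]
  push_cast
  linarith

lemma graphMap_antilipschitzWith (he : ‖e‖ = 1) : AntilipschitzWith 1 (graphMap e γ) := by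
  refine AntilipschitzWith.of_le_mul_dist fun x y => ?_
  rw [dist_eq_norm, dist_eq_norm, graphMap_sub, NNReal.coe_one, one_mul]
  exact norm_le_norm_perp_add_smul he _ _

lemma range_graphMap (he : ‖e‖ = 1) : Set.range (graphMap e γ) =
    {y | inner ℝ e y = γ (y - (inner ℝ e y : ℝ) • e)} := by
  ext y
  constructor
  · rintro ⟨x, rfl⟩
    simp only [Set.mem_ofPred_eq, graphMap]
    rw [perp_add_smul_sub he, inner_perp_add_smul he]
  · intro hy
    refine ⟨perpPart he y, ?_⟩
    rw [Set.mem_ofPred_eq] at hy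
    conv_rhs => rw [← perpPart_add_smul he y, hy]
    rfl

variable [FiniteDimensional ℝ E]

lemma hasFDerivAt_graphMap {x : (ℝ ∙ e)ᗮ} (h : DifferentiableAt ℝ (restrictPerp e γ) x) :
    HasFDerivAt (graphMap e γ)
      ((ℝ ∙ e)ᗮ.subtypeL + (fderiv ℝ (restrictPerp e γ) x).smulRight e) x :=
  ((ℝ ∙ e)ᗮ.subtypeL.hasFDerivAt).add (h.hasFDerivAt.smul_const e)

lemma normDet_fderiv_graphMap (he : ‖e‖ = 1) {x : (ℝ ∙ e)ᗮ}
    (h : DifferentiableAt ℝ (restrictPerp e γ) x) :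
    (fderiv ℝ (graphMap e γ) x : (ℝ ∙ e)ᗮ →ₗ[ℝ] E).normDet =
      √(1 + ‖gradient (restrictPerp e γ) x‖ ^ 2) := by
  set w := gradient (restrictPerp e γ) x with hw
  have hfd : ∀ z, fderiv ℝ (restrictPerp e γ) x z = inner ℝ w z := fun z => by
    rw [hw, gradient, InnerProductSpace.toDual_symm_apply]
  rw [(hasFDerivAt_graphMap h).fderiv]
  set A : (ℝ ∙ e)ᗮ →L[ℝ] E := (ℝ ∙ e)ᗮ.subtypeL + (fderiv ℝ (restrictPerp e γ) x).smulRight e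
    with hA
  have hAz : ∀ z, A z = z + (inner ℝ w z : ℝ) • e := fun z => by simp [hA, hfd]
  have h1 := ContinuousLinearMap.normDet_sq A
  -- `AᵀA = 1 + w ⊗ w`
  have h2 : ((ContinuousLinearMap.adjoint A ∘SL A : (ℝ ∙ e)ᗮ →L[ℝ] (ℝ ∙ e)ᗮ) :
      (ℝ ∙ e)ᗮ →ₗ[ℝ] (ℝ ∙ e)ᗮ) =
      LinearMap.transvection (innerSL ℝ w : (ℝ ∙ e)ᗮ →L[ℝ] ℝ).toLinearMap w := by
    ext1 z
    refine ext_inner_right ℝ fun y => ?_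
    simp only [ContinuousLinearMap.coe_coe, ContinuousLinearMap.comp_apply,
      ContinuousLinearMap.adjoint_inner_left, hAz, LinearMap.transvection, LinearMap.coe_mk,
      AddHom.coe_mk, innerSL_apply_apply]
    simp only [inner_add_left, inner_add_right, inner_smul_left, inner_smul_right,
      inner_perp_eq_zero, real_inner_comm e, real_inner_self_eq_norm_sq, he]
    simp [mul_comm]
  have h3 : (ContinuousLinearMap.adjoint A ∘SL A).det = 1 + ‖w‖ ^ 2 := by
    rw [ContinuousLinearMap.det, h2, LinearMap.transvection.det]
    simp
  rw [h3] at h1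
  rw [← Real.sqrt_sq (LinearMap.normDet_nonneg _)]
  congr 1

variable [MeasurableSpace E] [BorelSpace E]

/-- The surface measure of a Lipschitz graph, in the parametrization by the hyperplane. -/
theorem comap_graphMap_euclideanHausdorffMeasure (he : ‖e‖ = 1) (hγ : LipschitzWith K γ) :
    (μHE[Module.finrank ℝ (ℝ ∙ e)ᗮ] : Measure E).comap (graphMap e γ) =
      volume.withDensity fun x =>
        ENNReal.ofReal √(1 + ‖gradient (restrictPerp e γ) x‖ ^ 2) := by
  rw [comap_euclideanHausdorffMeasure_eq_withDensity (graphMap_lipschitzWith he hγ)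
    (graphMap_antilipschitzWith he)]
  refine withDensity_congr_ae ?_
  filter_upwards [(restrictPerp_lipschitzWith hγ).ae_differentiableAt (μ := volume)] with x hx
  rw [normDet_fderiv_graphMap he hx]

lemma measurable_gradient_restrictPerp :
    Measurable fun x => gradient (restrictPerp e γ) x :=
  (LinearIsometryEquiv.continuous _).measurable.comp (measurable_fderiv ℝ _)

lemma measurableEmbedding_graphMap (he : ‖e‖ = 1) (hγ : LipschitzWith K γ) :
    MeasurableEmbedding (graphMap e γ) :=
  ((graphMap_antilipschitzWith he).isClosedEmbedding
    (graphMap_lipschitzWith he hγ).uniformContinuous).measurableEmbedding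

/-- Surface integrals over a Lipschitz graph. -/
theorem integral_graph (he : ‖e‖ = 1) (hγ : LipschitzWith K γ) (h : E → ℝ) :
    ∫ y in Set.range (graphMap e γ), h y ∂μHE[Module.finrank ℝ (ℝ ∙ e)ᗮ] =
      ∫ x, √(1 + ‖gradient (restrictPerp e γ) x‖ ^ 2) * h (graphMap e γ x) := by
  have hemb := measurableEmbedding_graphMap he hγ
  rw [← hemb.map_comap, hemb.integral_map, comap_graphMap_euclideanHausdorffMeasure he hγ,
    integral_withDensity_eq_integral_toReal_smul]
  · refine integral_congr_ae (Eventually.of_forall fun x => ?_)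
    simp only [smul_eq_mul]
    rw [ENNReal.toReal_ofReal (Real.sqrt_nonneg _)]
  · have := measurable_gradient_restrictPerp (e := e) (γ := γ)
    fun_prop
  · exact Eventually.of_forall fun x => ENNReal.ofReal_lt_top

theorem integrableOn_graph_iff (he : ‖e‖ = 1) (hγ : LipschitzWith K γ) (h : E → ℝ) :
    IntegrableOn h (Set.range (graphMap e γ)) μHE[Module.finrank ℝ (ℝ ∙ e)ᗮ] ↔
      Integrable fun x => √(1 + ‖gradient (restrictPerp e γ) x‖ ^ 2) * h (graphMap e γ x) := by
  have hemb := measurableEmbedding_graphMap he hγ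
  rw [IntegrableOn, ← hemb.map_comap, hemb.integrable_map_iff,
    comap_graphMap_euclideanHausdorffMeasure he hγ,
    integrable_withDensity_iff_integrable_smul']
  · refine integrable_congr (Eventually.of_forall fun x => ?_)
    simp only [smul_eq_mul, Function.comp]
    rw [ENNReal.toReal_ofReal (Real.sqrt_nonneg _)]
  · have := measurable_gradient_restrictPerp (e := e) (γ := γ)
    fun_prop
  · exact Eventually.of_forall fun x => ENNReal.ofReal_lt_top

end Graph

/-! ### Cutoff functions and cones -/

section Cutoff

variable {E : Type*} [NormedAddCommGroup E] [NormedSpace ℝ E]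

/-- A smooth cutoff function equal to `1` in a neighbourhood of a compact set, not just on it. -/
lemma exists_contDiff_cutoff [FiniteDimensional ℝ E] {K U : Set E} (hK : IsCompact K)
    (hU : IsOpen U) (hKU : K ⊆ U) :
    ∃ η : E → ℝ, ContDiff ℝ ∞ η ∧ HasCompactSupport η ∧ tsupport η ⊆ U ∧
      ∀ x ∈ K, ∀ᶠ y in 𝓝 x, η y = 1 := by
  obtain ⟨L, hL, hKL, hLU⟩ := exists_compact_between hK hU hKU
  obtain ⟨f, hf1, hf0, -⟩ := exists_contMDiffMap_one_nhds_of_subset_interior (n := ⊤)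
    (modelWithCornersSelf ℝ E) hK.isClosed hKL
  have hsupp : tsupport f ⊆ L := by
    refine closure_minimal (fun x hx => ?_) hL.isClosed
    by_contra h
    exact hx (hf0 x h)
  exact ⟨f, f.contMDiff.contDiff, hL.of_isClosed_subset (isClosed_tsupport _) hsupp,
    hsupp.trans hLU, fun x hx => (eventually_nhdsSet_iff_forall.1 hf1) x hx⟩

/-- A function times a cutoff supported in an open set where the function is smooth. -/
lemma contDiff_mul_of_tsupport_subset {η φ : E → ℝ} {U : Set E} {m : WithTop ℕ∞}
    (hη : ContDiff ℝ m η) (hU : IsOpen U) (hηU : tsupport η ⊆ U) (hφ : ContDiffOn ℝ m φ U) :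
    ContDiff ℝ m fun x => η x * φ x := by
  refine contDiff_iff_contDiffAt.2 fun x => ?_
  by_cases hx : x ∈ U
  · exact hη.contDiffAt.mul (hφ.contDiffAt (hU.mem_nhds hx))
  · have hx' : x ∉ tsupport η := fun h => hx (hηU h)
    refine (contDiffAt_const (c := (0 : ℝ))).congr_of_eventuallyEq ?_
    filter_upwards [notMem_tsupport_iff_eventuallyEq.1 hx'] with y hy
    simp [hy]

lemma integrable_of_bounded_of_eq_zero_off_compact {X : Type*} [TopologicalSpace X]
    [MeasurableSpace X] [OpensMeasurableSpace X] [T2Space X] {μ : Measure X}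
    [IsFiniteMeasureOnCompacts μ] {f : X → ℝ} (hf : AEStronglyMeasurable f μ) {K : Set X}
    (hK : IsCompact K) (h0 : ∀ᵐ x ∂μ, x ∉ K → f x = 0) {M : ℝ} (hM : ∀ᵐ x ∂μ, ‖f x‖ ≤ M) :
    Integrable f μ := by
  have h1 : IntegrableOn f K μ :=
    Measure.integrableOn_of_bounded hK.measure_lt_top.ne hf (ae_restrict_of_ae hM)
  refine (integrable_indicator_iff hK.measurableSet).2 h1 |>.congr ?_
  filter_upwards [h0] with x hx
  by_cases h : x ∈ K
  · simp [h]
  · simp [h, hx h]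

end Cutoff

section SubgraphGeometry

variable {E : Type*} [NormedAddCommGroup E] [InnerProductSpace ℝ E] [FiniteDimensional ℝ E]
  {e : E} {γ : E → ℝ} {K : ℝ≥0}

set_option linter.unusedSectionVars false

lemma isOpen_subgraph (hγ : Continuous γ) : IsOpen (subgraph e γ) :=
  isOpen_lt (by fun_prop) (by fun_prop)

lemma isClosed_closedSubgraph (hγ : Continuous γ) : IsClosed (closedSubgraph e γ) :=
  isClosed_le (by fun_prop) (by fun_prop)

lemma subgraph_subset_closedSubgraph : subgraph e γ ⊆ closedSubgraph e γ :=
  fun y (h : inner ℝ e y < γ (y - (inner ℝ e y : ℝ) • e)) => h.le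

/-- A Lipschitz subgraph has unique derivatives at the points of the graph, because it contains an
open convex cone with vertex there. -/
lemma uniqueDiffWithinAt_subgraph (he : ‖e‖ = 1) (hγ : LipschitzWith K γ) {x : E}
    (hx : inner ℝ e x = γ (x - (inner ℝ e x : ℝ) • e)) :
    UniqueDiffWithinAt ℝ (subgraph e γ) x := by
  set P : E →L[ℝ] E := ContinuousLinearMap.id ℝ E - (innerSL ℝ e).smulRight e with hP
  have hPy : ∀ y, P y = y - (inner ℝ e y : ℝ) • e := fun y => by simp [hP]
  have hPe : P e = 0 := by rw [hPy, real_inner_self_eq_norm_sq, he]; simp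
  -- below the vertex `x`, the graph of `γ` stays above the cone of slope `K`
  set C : Set E := {y | inner ℝ e (y - x) + K * ‖P (y - x)‖ < 0} with hC
  have hCo : IsOpen C := isOpen_lt (by fun_prop) continuous_const
  have hCs : C ⊆ subgraph e γ := by
    intro y hy
    have hy' : inner ℝ e (y - x) + K * ‖P (y - x)‖ < 0 := hy
    have h1 := hγ.dist_le_mul (x - (inner ℝ e x : ℝ) • e) (y - (inner ℝ e y : ℝ) • e)
    rw [← hPy, ← hPy, Real.dist_eq, dist_eq_norm, ← map_sub, ← neg_sub y x, map_neg,
      norm_neg] at h1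
    have h2 := (abs_le.1 h1).2
    rw [inner_sub_right] at hy'
    change inner ℝ e y < γ (y - (inner ℝ e y : ℝ) • e)
    rw [← hPy] at hx ⊢
    linarith
  have hCc : Convex ℝ C := by
    have h : ConvexOn ℝ Set.univ fun y => inner ℝ e (y - x) + K * ‖P (y - x)‖ := by
      refine ⟨convex_univ, fun y _ z _ a b ha hb hab => ?_⟩
      have h3 : a • y + b • z - x = a • (y - x) + b • (z - x) := by
        have : x = (a + b) • x := by rw [hab, one_smul]
        conv_lhs => rw [this]
        rw [add_smul, smul_sub, smul_sub]; abel
      simp only [h3, smul_eq_mul]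
      rw [inner_add_right, inner_smul_right, inner_smul_right, map_add, map_smul, map_smul]
      have h4 := norm_add_le (a • P (y - x)) (b • P (z - x))
      rw [norm_smul, norm_smul, Real.norm_of_nonneg ha, Real.norm_of_nonneg hb] at h4
      have h5 := mul_le_mul_of_nonneg_left h4 K.coe_nonneg
      linarith
    simpa [hC] using h.convex_lt 0
  have hmem : ∀ s : ℝ, 0 < s → x - s • e ∈ C := by
    intro s hs
    change inner ℝ e (x - s • e - x) + K * ‖P (x - s • e - x)‖ < 0
    rw [sub_sub_cancel_left, map_neg, map_smul, hPe, inner_neg_right, inner_smul_right,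
      real_inner_self_eq_norm_sq, he]
    simp [hs]
  have hcl : x ∈ closure C := by
    have h1 : Tendsto (fun s : ℝ => x - s • e) (𝓝[>] 0) (𝓝 x) := by
      have : Continuous fun s : ℝ => x - s • e := by fun_prop
      simpa using (this.tendsto 0).mono_left nhdsWithin_le_nhds
    refine mem_closure_of_tendsto h1 ?_
    filter_upwards [self_mem_nhdsWithin] with s hs using hmem s hs
  have hne : (interior C).Nonempty := by
    rw [hCo.interior_eq]
    exact ⟨_, hmem 1 one_pos⟩
  exact (uniqueDiffWithinAt_convex hCc hne hcl).mono hCs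

lemma uniqueDiffOn_closedSubgraph (he : ‖e‖ = 1) (hγ : LipschitzWith K γ) :
    UniqueDiffOn ℝ (closedSubgraph e γ) := by
  intro x hx
  rcases lt_or_eq_of_le (show inner ℝ e x ≤ γ (x - (inner ℝ e x : ℝ) • e) from hx) with h | h
  · exact ((isOpen_subgraph hγ.continuous).uniqueDiffWithinAt h).mono
      subgraph_subset_closedSubgraph
  · exact (uniqueDiffWithinAt_subgraph he hγ h).mono subgraph_subset_closedSubgraph

variable [MeasurableSpace E] [BorelSpace E]

lemma measurePreserving_perp_add_smul (he : ‖e‖ = 1) :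
    MeasurePreserving (fun p : (ℝ ∙ e)ᗮ × ℝ => (p.1 : E) + p.2 • e)
      (volume.prod volume) volume := by
  have h1 := (ℝ ∙ e).measurePreserving_measurableEquivProd (0 : E)
  rw [InnerProductSpace.euclideanHausdorffMeasure_eq_volume] at h1
  have h2 := h1.symm
  have h3 := (LinearIsometryEquiv.toSpanUnitSingleton (𝕜 := ℝ) e he).measurePreserving
  have h4 : MeasurePreserving (Prod.map (LinearIsometryEquiv.toSpanUnitSingleton (𝕜 := ℝ) e he)
      (id : (ℝ ∙ e)ᗮ → (ℝ ∙ e)ᗮ)) (volume.prod volume) (volume.prod volume) :=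
    h3.prod (MeasurePreserving.id _)
  have h5 := (h2.comp h4).comp (Measure.measurePreserving_swap (μ := (volume : Measure (ℝ ∙ e)ᗮ))
    (ν := (volume : Measure ℝ)))
  have h6 : (fun p : (ℝ ∙ e)ᗮ × ℝ => (p.1 : E) + p.2 • e) =
      (((ℝ ∙ e).measurableEquivProd (0 : E)).symm ∘
        Prod.map (LinearIsometryEquiv.toSpanUnitSingleton (𝕜 := ℝ) e he) id) ∘ Prod.swap := by
    funext p
    simp [add_comm]
  rw [h6]
  exact h5

/-- The coordinates `(x, s) ↦ x + (γ(x) + s) e` which flatten the subgraph. -/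
def flattening (e : E) (γ : E → ℝ) (p : (ℝ ∙ e)ᗮ × ℝ) : E := graphMap e γ p.1 + p.2 • e

lemma flattening_eq (x : (ℝ ∙ e)ᗮ) (s : ℝ) :
    flattening e γ (x, s) = (x : E) + (γ x + s) • e := by
  simp [flattening, graphMap, add_smul, add_assoc]

lemma continuous_flattening (hγ : Continuous γ) : Continuous (flattening e γ) := by
  unfold flattening graphMap
  fun_prop

/-- The flattening coordinates as a homeomorphism. -/
def flatteningHomeomorph (he : ‖e‖ = 1) (hγ : Continuous γ) : (ℝ ∙ e)ᗮ × ℝ ≃ₜ E where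
  toFun := flattening e γ
  invFun y := (perpPart he y, inner ℝ e y - γ (y - (inner ℝ e y : ℝ) • e))
  left_inv := by
    rintro ⟨x, s⟩
    rw [flattening_eq]
    refine Prod.ext (Subtype.ext ?_) ?_
    · exact perp_add_smul_sub he x _
    · simp only
      rw [perp_add_smul_sub he, inner_perp_add_smul he, add_sub_cancel_left]
  right_inv y := by
    rw [flattening_eq]
    simp [perpPart]
  continuous_toFun := continuous_flattening hγ
  continuous_invFun := by
    refine Continuous.prodMk (Continuous.subtype_mk (by fun_prop) _) (by fun_prop)

/-- The flattening coordinates preserve volume: they are a shear followed by an isometry. -/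
lemma measurePreserving_flattening (he : ‖e‖ = 1) (hγ : Continuous γ) :
    MeasurePreserving (flattening e γ) (volume.prod volume) volume := by
  have h1 : MeasurePreserving (fun p : (ℝ ∙ e)ᗮ × ℝ => (p.1, γ p.1 + p.2))
      (volume.prod volume) (volume.prod volume) := by
    refine MeasurePreserving.skew_product (f := (id : (ℝ ∙ e)ᗮ → (ℝ ∙ e)ᗮ))
      (g := fun x s => γ x + s) (MeasurePreserving.id _) ?_ ?_
    · have : Continuous (Function.uncurry fun (x : (ℝ ∙ e)ᗮ) (s : ℝ) => γ x + s) := by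
        unfold Function.uncurry
        fun_prop
      exact this.measurable
    · exact Eventually.of_forall fun x => (measurePreserving_add_left volume (γ x)).map_eq
  have h2 : flattening e γ = (fun p : (ℝ ∙ e)ᗮ × ℝ => (p.1 : E) + p.2 • e) ∘
      fun p : (ℝ ∙ e)ᗮ × ℝ => (p.1, γ p.1 + p.2) := by
    funext p
    exact flattening_eq p.1 p.2
  rw [h2]
  exact (measurePreserving_perp_add_smul he).comp h1

lemma flattening_mem_subgraph (he : ‖e‖ = 1) (x : (ℝ ∙ e)ᗮ) (s : ℝ) :
    flattening e γ (x, s) ∈ subgraph e γ ↔ s < 0 := by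
  rw [flattening_eq, perp_add_smul_mem_subgraph he]
  constructor <;> intro h <;> linarith

lemma flattening_mem_closedSubgraph (he : ‖e‖ = 1) (x : (ℝ ∙ e)ᗮ) (s : ℝ) :
    flattening e γ (x, s) ∈ closedSubgraph e γ ↔ s ≤ 0 := by
  rw [flattening_eq, perp_add_smul_mem_closedSubgraph he]
  constructor <;> intro h <;> linarith

/-- Integrals over the subgraph in flattening coordinates. -/
lemma setIntegral_subgraph_eq (he : ‖e‖ = 1) (hγ : Continuous γ) (F : E → ℝ) :
    ∫ y in subgraph e γ, F y =
      ∫ p in Set.univ ×ˢ Set.Iio (0 : ℝ), F (flattening e γ p) ∂(volume.prod volume) := by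
  rw [← (measurePreserving_flattening he hγ).setIntegral_preimage_emb
    (flatteningHomeomorph he hγ).measurableEmbedding]
  congr 2
  ext ⟨x, s⟩
  simp [flattening_mem_subgraph he]

end SubgraphGeometry

/-! ### The divergence theorem below a Lipschitz graph -/

section SubgraphGauss

variable {E : Type*} [NormedAddCommGroup E] [InnerProductSpace ℝ E] [FiniteDimensional ℝ E]
  [MeasurableSpace E] [BorelSpace E] {e : E} {γ : E → ℝ} {K : ℝ≥0} {φ : E → ℝ}

set_option linter.unusedSectionVars false

lemma contDiffOn_subgraph (hφ : ContDiffOn ℝ 1 φ (closedSubgraph e γ)) :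
    ContDiffOn ℝ 1 φ (subgraph e γ) := hφ.mono subgraph_subset_closedSubgraph

lemma exists_norm_fderiv_le_on_subgraph (he : ‖e‖ = 1) (hγ : LipschitzWith K γ)
    (hφ : ContDiffOn ℝ 1 φ (closedSubgraph e γ)) (hc : HasCompactSupport φ) :
    ∃ M : ℝ, 0 ≤ M ∧ ∀ y ∈ subgraph e γ, ‖fderiv ℝ φ y‖ ≤ M := by
  have hcont := hφ.continuousOn_fderivWithin (uniqueDiffOn_closedSubgraph he hγ) le_rfl
  have hK : IsCompact (tsupport φ ∩ closedSubgraph e γ) :=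
    hc.isCompact.inter_right (isClosed_closedSubgraph hγ.continuous)
  obtain ⟨M, hM⟩ := hK.exists_bound_of_continuousOn (hcont.mono Set.inter_subset_right)
  refine ⟨max M 0, le_max_right _ _, fun y hy => ?_⟩
  by_cases hy' : y ∈ tsupport φ
  · have h1 := hM y ⟨hy', subgraph_subset_closedSubgraph hy⟩
    rw [fderivWithin_of_mem_nhds (mem_of_superset ((isOpen_subgraph hγ.continuous).mem_nhds hy)
      subgraph_subset_closedSubgraph)] at h1
    exact h1.trans (le_max_left _ _)
  · have h2 : fderiv ℝ φ y = 0 := by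
      by_contra h
      exact hy' (support_fderiv_subset ℝ h)
    rw [h2]
    simp

lemma norm_gradient_restrictPerp_le (hγ : LipschitzWith K γ) (x : (ℝ ∙ e)ᗮ) :
    ‖gradient (restrictPerp e γ) x‖ ≤ K := by
  rw [gradient, LinearIsometryEquiv.norm_map]
  exact norm_fderiv_le_of_lipschitz ℝ (restrictPerp_lipschitzWith hγ)

/-- Along a translate of the graph inside the subgraph, the tangential derivative of a compactly
supported function integrates to zero. -/
lemma integral_tangential_fderiv_eq_zero (he : ‖e‖ = 1) (hγ : LipschitzWith K γ)
    (hφ : ContDiffOn ℝ 1 φ (closedSubgraph e γ)) (hc : HasCompactSupport φ) {s : ℝ} (hs : s < 0)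
    (v : (ℝ ∙ e)ᗮ) :
    ∫ x, fderiv ℝ φ (flattening e γ (x, s))
      ((v : E) + (inner ℝ (gradient (restrictPerp e γ) x) v : ℝ) • e) = 0 := by
  have hΩ := isOpen_subgraph (e := e) hγ.continuous
  have hemb : IsClosedEmbedding fun x => flattening e γ (x, s) :=
    (flatteningHomeomorph he hγ.continuous).isClosedEmbedding.comp
      (Topology.IsClosedEmbedding.of_continuous_injective_isClosedMap (by fun_prop)
        (fun x y h => (Prod.ext_iff.1 h).1) (isClosedMap_prodMk_right _))
  -- replace `φ` by a globally `C¹` function, equal to it near the translated graph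
  have hK0 : IsCompact (tsupport φ ∩ Set.range fun x => flattening e γ (x, s)) :=
    hc.isCompact.inter_right hemb.isClosed_range
  obtain ⟨η, hη, hηc, hηΩ, hη1⟩ := exists_contDiff_cutoff hK0 hΩ (by
    rintro _ ⟨-, x, rfl⟩
    exact (flattening_mem_subgraph he x s).2 hs)
  set ψ : E → ℝ := fun y => η y * φ y with hψ
  have hψs : ContDiff ℝ 1 ψ := contDiff_mul_of_tsupport_subset (hη.of_le (by simp)) hΩ hηΩ
    (contDiffOn_subgraph hφ)
  have hψc : HasCompactSupport ψ := hc.mul_left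
  have hfd : ∀ x, fderiv ℝ ψ (flattening e γ (x, s)) = fderiv ℝ φ (flattening e γ (x, s)) := by
    intro x
    by_cases hx : flattening e γ (x, s) ∈ tsupport φ
    · refine Filter.EventuallyEq.fderiv_eq ?_
      filter_upwards [hη1 _ ⟨hx, x, rfl⟩] with y hy
      simp [hψ, hy]
    · have h0 := notMem_tsupport_iff_eventuallyEq.1 hx
      refine Filter.EventuallyEq.fderiv_eq ?_
      filter_upwards [h0] with y hy
      simp [hψ, hy]
  obtain ⟨C, hC⟩ := hψs.lipschitzWith_of_hasCompactSupport hψc one_ne_zero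
  have hlipf : LipschitzWith (1 + K) fun x => flattening e γ (x, s) := by
    refine LipschitzWith.of_dist_le_mul fun x y => ?_
    simp only [flattening, dist_add_right]
    exact (graphMap_lipschitzWith he hγ).dist_le_mul x y
  -- integration by parts against the constant `1`, valid for Lipschitz functions of compact support
  have h1 := LipschitzWith.integral_lineDeriv_mul_eq (μ := (volume : Measure (ℝ ∙ e)ᗮ))
    (f := fun _ => (1 : ℝ)) (LipschitzWith.const' (K := 0) (1 : ℝ)) (hC.comp hlipf)
    (hψc.comp_isClosedEmbedding hemb) (-v)
  simp only [neg_neg, mul_one] at h1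
  have h2 : ∀ᵐ x : (ℝ ∙ e)ᗮ, lineDeriv ℝ (ψ ∘ fun x => flattening e γ (x, s)) x v =
      fderiv ℝ φ (flattening e γ (x, s))
        ((v : E) + (inner ℝ (gradient (restrictPerp e γ) x) v : ℝ) • e) := by
    filter_upwards [(restrictPerp_lipschitzWith hγ).ae_differentiableAt (μ := volume)] with x hx
    have h3 : HasFDerivAt (fun x => flattening e γ (x, s))
        ((ℝ ∙ e)ᗮ.subtypeL + (fderiv ℝ (restrictPerp e γ) x).smulRight e) x :=
      (hasFDerivAt_graphMap hx).add_const (s • e)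
    have h4 := ((hψs.differentiable one_ne_zero
      (flattening e γ (x, s))).hasFDerivAt.comp x h3).hasLineDerivAt v
    rw [h4.lineDeriv, ContinuousLinearMap.comp_apply, hfd]
    simp
  rw [← integral_congr_ae h2, ← h1]
  have h5 : ∀ x v : (ℝ ∙ e)ᗮ, lineDeriv ℝ (fun _ : (ℝ ∙ e)ᗮ => (1 : ℝ)) x v = 0 := fun x v => by
    simp [lineDeriv]
  simp [h5]

/-- Along the lines parallel to `e`, the fundamental theorem of calculus. -/
lemma setIntegral_fderiv_normal_eq (he : ‖e‖ = 1) (hγ : LipschitzWith K γ)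
    (hφ : ContDiffOn ℝ 1 φ (closedSubgraph e γ)) (hc : HasCompactSupport φ) (x : (ℝ ∙ e)ᗮ) :
    ∫ s in Set.Iio (0 : ℝ), fderiv ℝ φ (flattening e γ (x, s)) e = φ (graphMap e γ x) := by
  have hemb : IsClosedEmbedding fun s : ℝ => flattening e γ (x, s) :=
    (flatteningHomeomorph he hγ.continuous).isClosedEmbedding.comp
      (Topology.IsClosedEmbedding.of_continuous_injective_isClosedMap (by fun_prop)
        (fun x y h => (Prod.ext_iff.1 h).2) (isClosedMap_prodMk_left _))
  have hsupp := hc.comp_isClosedEmbedding hemb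
  obtain ⟨M, hM0, hM⟩ := exists_norm_fderiv_le_on_subgraph he hγ hφ hc
  have hmeas : Measurable fun s : ℝ => fderiv ℝ φ (flattening e γ (x, s)) e :=
    (measurable_fderiv_apply_const ℝ φ e).comp hemb.continuous.measurable
  have hint : IntegrableOn (fun s : ℝ => fderiv ℝ φ (flattening e γ (x, s)) e) (Set.Iio 0) := by
    refine integrable_of_bounded_of_eq_zero_off_compact hmeas.aestronglyMeasurable
      (K := (fun s : ℝ => flattening e γ (x, s)) ⁻¹' tsupport φ)
      (hemb.isCompact_preimage hc.isCompact) (M := M * ‖e‖) ?_ ?_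
    · refine Eventually.of_forall fun s hs => ?_
      have h2 : fderiv ℝ φ (flattening e γ (x, s)) = 0 := by
        by_contra h
        exact hs (support_fderiv_subset ℝ h)
      rw [h2]; rfl
    · filter_upwards [ae_restrict_mem measurableSet_Iio] with s hs
      exact (fderiv ℝ φ _).le_of_opNorm_le (hM _ ((flattening_mem_subgraph he x s).2 hs)) e
  rw [← integral_Iic_eq_integral_Iio]
  rw [integral_Iic_of_hasDerivAt_of_tendsto (f := fun s : ℝ => φ (flattening e γ (x, s))) (m := 0)]
  · simp [flattening]
  · have h1 : ContinuousOn (fun s : ℝ => φ (flattening e γ (x, s))) (Set.Iic 0) :=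
      hφ.continuousOn.comp hemb.continuous.continuousOn fun s hs =>
        (flattening_mem_closedSubgraph he x s).2 hs
    exact h1 0 Set.self_mem_Iic
  · intro s hs
    have hmem := (flattening_mem_subgraph (γ := γ) he x s).2 hs
    have h1 := (((contDiffOn_subgraph hφ).contDiffAt
      ((isOpen_subgraph hγ.continuous).mem_nhds hmem)).differentiableAt one_ne_zero).hasFDerivAt
    have h2 : HasDerivAt (fun s : ℝ => flattening e γ (x, s)) e s := by
      have := ((hasDerivAt_id s).smul_const e).const_add (graphMap e γ x)
      simpa [flattening] using this
    exact h1.comp_hasDerivAt s h2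
  · rwa [integrableOn_Iic_iff_integrableOn_Iio]
  · have h1 : Tendsto (φ ∘ fun s : ℝ => flattening e γ (x, s)) (cocompact ℝ) (𝓝 0) :=
      tendsto_const_nhds.congr' ((hasCompactSupport_iff_eventuallyEq.1 hsupp).filter_mono
        Filter.cocompact_le_coclosedCompact).symm
    exact h1.mono_left atBot_le_cocompact

lemma integrableOn_flattening_fderiv (he : ‖e‖ = 1) (hγ : LipschitzWith K γ)
    (hφ : ContDiffOn ℝ 1 φ (closedSubgraph e γ)) (hc : HasCompactSupport φ)
    {c : (ℝ ∙ e)ᗮ → E} (hcm : Measurable c) {B : ℝ} (hB : ∀ x, ‖c x‖ ≤ B) :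
    IntegrableOn (fun p : (ℝ ∙ e)ᗮ × ℝ => fderiv ℝ φ (flattening e γ p) (c p.1))
      (Set.univ ×ˢ Set.Iio 0) (volume.prod volume) := by
  obtain ⟨M, hM0, hM⟩ := exists_norm_fderiv_le_on_subgraph he hγ hφ hc
  have hmeas : Measurable fun p : (ℝ ∙ e)ᗮ × ℝ => fderiv ℝ φ (flattening e γ p) (c p.1) := by
    have h1 : Measurable fun p : (ℝ ∙ e)ᗮ × ℝ => fderiv ℝ φ (flattening e γ p) :=
      (measurable_fderiv ℝ φ).comp (continuous_flattening hγ.continuous).measurable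
    have h2 : Measurable fun p : (ℝ ∙ e)ᗮ × ℝ => c p.1 := hcm.comp measurable_fst
    exact (isBoundedBilinearMap_apply (𝕜 := ℝ) (E := E) (F := ℝ)).continuous.measurable.comp
      (h1.prodMk h2)
  refine integrable_of_bounded_of_eq_zero_off_compact hmeas.aestronglyMeasurable
    (K := flattening e γ ⁻¹' tsupport φ)
    ((flatteningHomeomorph he hγ.continuous).isClosedEmbedding.isCompact_preimage hc.isCompact)
    (M := M * B) ?_ ?_
  · refine Eventually.of_forall fun p hp => ?_
    have h2 : fderiv ℝ φ (flattening e γ p) = 0 := by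
      by_contra h
      exact hp (support_fderiv_subset ℝ h)
    rw [h2]; rfl
  · filter_upwards [ae_restrict_mem (MeasurableSet.univ.prod measurableSet_Iio)] with p hp
    refine (ContinuousLinearMap.le_opNorm _ _).trans ?_
    exact mul_le_mul (hM _ ((flattening_mem_subgraph he p.1 p.2).2 hp.2)) (hB _) (norm_nonneg _) hM0

/-- The divergence theorem below a Lipschitz graph, for a function with compact support. In the
flattening coordinates the tangential part of the derivative integrates to zero on each translate of
the graph, and the normal part is integrated along lines. -/
theorem setIntegral_subgraph_fderiv (he : ‖e‖ = 1) (hγ : LipschitzWith K γ)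
    (hφ : ContDiffOn ℝ 1 φ (closedSubgraph e γ)) (hc : HasCompactSupport φ) (v : E) :
    ∫ y in subgraph e γ, fderiv ℝ φ y v =
      ∫ x : (ℝ ∙ e)ᗮ, inner ℝ v (e - ((gradient (restrictPerp e γ) x : (ℝ ∙ e)ᗮ) : E)) *
        φ (graphMap e γ x) := by
  set a : ℝ := inner ℝ e v with ha
  set v' : (ℝ ∙ e)ᗮ := perpPart he v with hv'
  have hv : (v' : E) + a • e = v := perpPart_add_smul he v
  set g : (ℝ ∙ e)ᗮ → ℝ := fun x => inner ℝ (gradient (restrictPerp e γ) x) v' with hg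
  have hgm : Measurable g := (measurable_gradient_restrictPerp (e := e) (γ := γ)).inner_const
  have hgb : ∀ x, |g x| ≤ K * ‖v'‖ := fun x => by
    refine (abs_real_inner_le_norm _ _).trans ?_
    gcongr
    exact norm_gradient_restrictPerp_le hγ x
  have hI1 := integrableOn_flattening_fderiv (c := fun x => (v' : E) + g x • e) he hγ hφ hc
    (by fun_prop) (B := ‖(v' : E)‖ + K * ‖v'‖) (fun x => by
      refine (norm_add_le _ _).trans ?_
      rw [norm_smul, he, mul_one]
      exact add_le_add le_rfl (hgb x))
  have hI2 := integrableOn_flattening_fderiv (c := fun x => (a - g x) • e) he hγ hφ hc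
    (by fun_prop) (B := |a| + K * ‖v'‖) (fun x => by
      rw [norm_smul, he, mul_one]
      exact (abs_sub _ _).trans (add_le_add le_rfl (hgb x)))
  -- `v = (v' + ⟪∇γ, v'⟫ e) + (a - ⟪∇γ, v'⟫) e`: a tangent vector of the graph and a multiple of `e`
  have hsplit : ∀ p : (ℝ ∙ e)ᗮ × ℝ, fderiv ℝ φ (flattening e γ p) v =
      fderiv ℝ φ (flattening e γ p) ((v' : E) + g p.1 • e) +
        fderiv ℝ φ (flattening e γ p) ((a - g p.1) • e) := by
    intro p
    rw [← map_add, add_assoc, ← add_smul, add_sub_cancel, hv]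
  rw [setIntegral_subgraph_eq he hγ.continuous]
  simp_rw [hsplit]
  rw [integral_add hI1 hI2, setIntegral_prod _ hI2]
  have h1 : ∫ p in Set.univ ×ˢ Set.Iio (0 : ℝ), fderiv ℝ φ (flattening e γ p)
      ((v' : E) + g p.1 • e) ∂((volume : Measure (ℝ ∙ e)ᗮ).prod volume) = 0 := by
    rw [setIntegral_prod _ hI1, integral_integral_swap]
    · refine setIntegral_eq_zero_of_forall_eq_zero fun s hs => ?_
      rw [Measure.restrict_univ]
      exact integral_tangential_fderiv_eq_zero he hγ hφ hc hs v'
    · rwa [IntegrableOn, ← Measure.prod_restrict] at hI1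
  rw [h1, zero_add, Measure.restrict_univ]
  refine integral_congr_ae (Eventually.of_forall fun x => ?_)
  simp only [map_smul, smul_eq_mul]
  rw [integral_const_mul, setIntegral_fderiv_normal_eq he hγ hφ hc x]
  congr 1
  rw [inner_sub_right, ha, real_inner_comm, hg]
  congr 1
  conv_rhs => rw [← hv]
  rw [inner_add_left, inner_smul_left, inner_perp_eq_zero, mul_zero, add_zero, real_inner_comm]
  rfl

end SubgraphGauss

/-! ### The outward normal of a Lipschitz domain -/

section Normal

variable {n : ℕ} {D : Set (EuclideanSpace ℝ (Fin n))} {e : EuclideanSpace ℝ (Fin n)}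
  {γ : EuclideanSpace ℝ (Fin n) → ℝ} {K : ℝ≥0} {U : Set (EuclideanSpace ℝ (Fin n))}

/-- Were there two normals, moving in the direction of their difference would leave `D` according to
one of them and enter it according to the other. -/
lemma IsOutwardUnitNormal.unique {x ν₁ ν₂ : EuclideanSpace ℝ (Fin n)}
    (h₁ : IsOutwardUnitNormal D x ν₁) (h₂ : IsOutwardUnitNormal D x ν₂) : ν₁ = ν₂ := by
  by_contra hne
  set z := ν₂ - ν₁ with hz
  set c : ℝ := inner ℝ ν₁ ν₂ with hc
  have hzpos : 0 < ‖z‖ := norm_pos_iff.2 (sub_ne_zero.2 (Ne.symm hne))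
  have hz1 : inner ℝ z ν₁ = c - 1 := by
    rw [hz, inner_sub_left, real_inner_self_eq_norm_sq, h₁.1, real_inner_comm]; norm_num [hc]
  have hz2 : inner ℝ z ν₂ = 1 - c := by
    rw [hz, inner_sub_left, real_inner_self_eq_norm_sq, h₂.1]; norm_num [hc]
  have hc1 : 0 < 1 - c := by
    have h3 : ‖z‖ ^ 2 = 2 * (1 - c) := by
      rw [hz, norm_sub_sq_real, h₁.1, h₂.1, real_inner_comm]; ring
    nlinarith [pow_pos hzpos 2]
  have hε : 0 < (1 - c) / (2 * ‖z‖) := by positivity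
  have hlim : Tendsto (fun s : ℝ => x + s • z) (𝓝[>] 0) (𝓝 x) := by
    have : Continuous fun s : ℝ => x + s • z := by fun_prop
    simpa using (this.tendsto 0).mono_left nhdsWithin_le_nhds
  obtain ⟨s, hs1, hs2, hs⟩ := ((hlim.eventually (h₁.2 _ hε)).and
    ((hlim.eventually (h₂.2 _ hε)).and self_mem_nhdsWithin)).exists
  have hs' : (0 : ℝ) < s := hs
  have hkey : (1 - c) / (2 * ‖z‖) * ‖s • z‖ = s * (1 - c) / 2 := by
    rw [norm_smul, Real.norm_of_nonneg hs'.le]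
    field_simp
  have hsc : 0 < s * (1 - c) := mul_pos hs' hc1
  refine hs2.2 ?_ (hs1.1 ?_)
  · rw [add_sub_cancel_left, inner_smul_left, hz2, hkey]
    simp only [conj_trivial]
    linarith
  · rw [add_sub_cancel_left, inner_smul_left, hz1, hkey]
    simp only [conj_trivial]
    linarith

lemma IsOutwardUnitNormal.outwardNormal_eq {x ν : EuclideanSpace ℝ (Fin n)}
    (h : IsOutwardUnitNormal D x ν) : outwardNormal D x = ν := by
  have hex : ∃ ν, IsOutwardUnitNormal D x ν := ⟨ν, h⟩
  rw [outwardNormal, dif_pos hex]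
  exact hex.choose_spec.unique h

lemma norm_sub_gradient (he : ‖e‖ = 1) (w : (ℝ ∙ e)ᗮ) :
    ‖e - (w : EuclideanSpace ℝ (Fin n))‖ = √(1 + ‖w‖ ^ 2) := by
  have h : ‖e - (w : EuclideanSpace ℝ (Fin n))‖ ^ 2 = 1 + ‖w‖ ^ 2 := by
    rw [norm_sub_sq_real, inner_perp_eq_zero, he, Submodule.norm_coe]
    ring
  rw [← h, Real.sqrt_sq (norm_nonneg _)]

/-- Where the graph is differentiable, the normalized vector `e - ∇γ` is the outward normal. -/
lemma isOutwardUnitNormal_graphMap (he : ‖e‖ = 1) (hU : IsOpen U)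
    (hDU : ∀ y ∈ U, (y ∈ D ↔ y ∈ subgraph e γ)) {x : (ℝ ∙ e)ᗮ} (hx : graphMap e γ x ∈ U)
    (hd : DifferentiableAt ℝ (restrictPerp e γ) x) :
    IsOutwardUnitNormal D (graphMap e γ x)
      ((√(1 + ‖gradient (restrictPerp e γ) x‖ ^ 2))⁻¹ •
        (e - ((gradient (restrictPerp e γ) x : (ℝ ∙ e)ᗮ) : EuclideanSpace ℝ (Fin n)))) := by
  set w : (ℝ ∙ e)ᗮ := gradient (restrictPerp e γ) x with hw
  set J : ℝ := √(1 + ‖w‖ ^ 2) with hJ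
  have hJ1 : 1 ≤ J := by
    rw [hJ]; exact Real.one_le_sqrt.2 (by nlinarith [sq_nonneg ‖w‖])
  have hJ0 : 0 < J := by linarith
  refine ⟨?_, fun ε hε => ?_⟩
  · rw [norm_smul, norm_sub_gradient he, ← hJ, norm_inv, Real.norm_of_nonneg hJ0.le]
    exact inv_mul_cancel₀ hJ0.ne'
  have hlit := hd.hasFDerivAt.isLittleO.def hε
  have hpc : Continuous fun y => perpPart he y := Continuous.subtype_mk (by fun_prop) _
  have hpx : perpPart he (graphMap e γ x) = x := Subtype.ext (perp_add_smul_sub he x _)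
  have hlim : Tendsto (fun y => perpPart he y) (𝓝 (graphMap e γ x)) (𝓝 x) := by
    simpa [hpx] using hpc.tendsto (graphMap e γ x)
  filter_upwards [hlim.eventually hlit, hU.mem_nhds hx] with y hy hyU
  have h1 : ‖perpPart he y - x‖ ≤ ‖y - graphMap e γ x‖ := by
    have h2 : y - graphMap e γ x = ((perpPart he y - x : (ℝ ∙ e)ᗮ) : EuclideanSpace ℝ (Fin n)) +
        ((inner ℝ e y : ℝ) - γ x) • e := by
      conv_lhs => rw [← perpPart_add_smul he y]
      simp only [graphMap, sub_smul, Submodule.coe_sub]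
      abel
    rw [h2]
    exact norm_le_norm_perp_add_smul he _ _
  have h3 : inner ℝ (y - graphMap e γ x) (e - (w : EuclideanSpace ℝ (Fin n))) =
      (inner ℝ e y - γ x) - fderiv ℝ (restrictPerp e γ) x (perpPart he y - x) := by
    have h4 : fderiv ℝ (restrictPerp e γ) x (perpPart he y - x) =
        inner ℝ (w : EuclideanSpace ℝ (Fin n)) (y - graphMap e γ x) := by
      rw [← InnerProductSpace.toDual_symm_apply]
      change inner ℝ (w : EuclideanSpace ℝ (Fin n))
        ((perpPart he y - x : (ℝ ∙ e)ᗮ) : EuclideanSpace ℝ (Fin n)) = _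
      simp only [graphMap, perpPart, Submodule.coe_sub, inner_sub_right, inner_add_right,
        inner_smul_right, real_inner_comm e (w : EuclideanSpace ℝ (Fin n)), inner_perp_eq_zero]
      ring
    rw [h4, inner_sub_right, real_inner_comm, inner_sub_right,
      real_inner_comm (y - graphMap e γ x) (w : EuclideanSpace ℝ (Fin n))]
    congr 2
    exact inner_perp_add_smul he x _
  have h5 := (abs_le.1 hy)
  simp only [restrictPerp] at h5
  have hyD := hDU y hyU
  change _ ↔ inner ℝ e y < γ ((perpPart he y : (ℝ ∙ e)ᗮ) : EuclideanSpace ℝ (Fin n)) at hyD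
  have h6 : ε * ‖perpPart he y - x‖ ≤ ε * ‖y - graphMap e γ x‖ := by gcongr
  have hN : 0 ≤ ε * ‖y - graphMap e γ x‖ := by positivity
  have h7 : ∀ a : ℝ, 0 ≤ a → a ≤ J * a := fun a ha => by nlinarith
  have h8 := h7 _ hN
  rw [inner_smul_right, h3]
  constructor
  · intro h9
    rw [inv_mul_lt_iff₀ hJ0] at h9
    rw [hyD]
    linarith [h5.1]
  · intro h9
    rw [lt_inv_mul_iff₀ hJ0] at h9
    rw [hyD, not_lt]
    linarith [h5.2]

end Normal

/-! ### The divergence theorem and Green's identity on a Lipschitz domain -/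

section Gauss

variable {n : ℕ} {D : Set (EuclideanSpace ℝ (Fin n))} {e : EuclideanSpace ℝ (Fin n)}
  {γ : EuclideanSpace ℝ (Fin n) → ℝ} {K : ℝ≥0} {U : Set (EuclideanSpace ℝ (Fin n))}
  {φ : EuclideanSpace ℝ (Fin n) → ℝ}

lemma closedSubgraph_eq_closure (he : ‖e‖ = 1) (hγ : Continuous γ) :
    closedSubgraph e γ = closure (subgraph e γ) := by
  refine Set.Subset.antisymm (fun y hy => ?_)
    (closure_minimal subgraph_subset_closedSubgraph (isClosed_closedSubgraph hγ))
  rw [← perpPart_add_smul he y] at hy ⊢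
  rw [perp_add_smul_mem_closedSubgraph he] at hy
  set t : ℝ := inner ℝ e y
  have h1 : Tendsto (fun s : ℝ => (perpPart he y : EuclideanSpace ℝ (Fin n)) + (t - s) • e)
      (𝓝[>] 0) (𝓝 ((perpPart he y : EuclideanSpace ℝ (Fin n)) + t • e)) := by
    have : Continuous fun s : ℝ => (perpPart he y : EuclideanSpace ℝ (Fin n)) + (t - s) • e := by
      fun_prop
    simpa using (this.tendsto 0).mono_left nhdsWithin_le_nhds
  refine mem_closure_of_tendsto h1 ?_
  filter_upwards [self_mem_nhdsWithin] with s hs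
  rw [perp_add_smul_mem_subgraph he]
  have : (0 : ℝ) < s := hs
  linarith

lemma mem_closure_iff_mem_closedSubgraph (he : ‖e‖ = 1) (hγ : Continuous γ) (hU : IsOpen U)
    (hDU : ∀ y ∈ U, (y ∈ D ↔ y ∈ subgraph e γ)) {y : EuclideanSpace ℝ (Fin n)} (hy : y ∈ U) :
    y ∈ closure D ↔ y ∈ closedSubgraph e γ := by
  rw [closedSubgraph_eq_closure he hγ, mem_closure_iff_frequently, mem_closure_iff_frequently]
  refine frequently_congr ?_
  filter_upwards [hU.mem_nhds hy] with z hz using hDU z hz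

lemma mem_frontier_iff_mem_range_graphMap (he : ‖e‖ = 1) (hγ : Continuous γ) (hD : IsOpen D)
    (hU : IsOpen U) (hDU : ∀ y ∈ U, (y ∈ D ↔ y ∈ subgraph e γ))
    {y : EuclideanSpace ℝ (Fin n)} (hy : y ∈ U) :
    y ∈ frontier D ↔ y ∈ Set.range (graphMap e γ) := by
  rw [hD.frontier_eq, Set.mem_sdiff, mem_closure_iff_mem_closedSubgraph he hγ hU hDU hy,
    hDU y hy, range_graphMap he]
  change (inner ℝ e y ≤ γ (y - (inner ℝ e y : ℝ) • e) ∧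
    ¬ inner ℝ e y < γ (y - (inner ℝ e y : ℝ) • e)) ↔
    inner ℝ e y = γ (y - (inner ℝ e y : ℝ) • e)
  constructor
  · rintro ⟨h1, h2⟩; linarith
  · intro h; exact ⟨h.le, by linarith⟩

lemma finrank_perp (he : ‖e‖ = 1) : Module.finrank ℝ (ℝ ∙ e)ᗮ = n - 1 := by
  have h1 := (ℝ ∙ e).finrank_add_finrank_orthogonal
  have h2 : e ≠ 0 := fun h => by simp [h] at he
  rw [finrank_span_singleton h2, finrank_euclideanSpace_fin] at h1
  omega

lemma indicator_eq_indicator_of_eq_zero_off {X : Type*} {S T U : Set X} {F : X → ℝ}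
    (h : ∀ y ∈ U, (y ∈ S ↔ y ∈ T)) (h0 : ∀ y ∉ U, F y = 0) : S.indicator F = T.indicator F := by
  classical
  funext y
  by_cases hy : y ∈ U
  · simp only [Set.indicator_apply, h y hy]
  · simp only [Set.indicator_apply, h0 y hy, ite_self]

/-- The divergence theorem in a chart. -/
lemma gauss_of_tsupport_subset_chart (hD : IsOpen D) (he : ‖e‖ = 1) (hγ : LipschitzWith K γ)
    (hU : IsOpen U) (hDU : ∀ y ∈ U, (y ∈ D ↔ y ∈ subgraph e γ))
    (hφ : ContDiffOn ℝ 1 φ (closure D)) (hc : HasCompactSupport φ) (hφU : tsupport φ ⊆ U)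
    (v : EuclideanSpace ℝ (Fin n)) :
    Integrable (fun s => φ s * inner ℝ v (outwardNormal D s)) (surfaceMeasure D) ∧
    ∫ y in D, fderiv ℝ φ y v = ∫ s, φ s * inner ℝ v (outwardNormal D s) ∂(surfaceMeasure D) := by
  have hγc := hγ.continuous
  have hφS : ContDiffOn ℝ 1 φ (closedSubgraph e γ) := by
    intro y hy
    by_cases hyU : y ∈ U
    · have hyD := (mem_closure_iff_mem_closedSubgraph he hγc hU hDU hyU).2 hy
      refine (hφ y hyD).congr_set ?_
      filter_upwards [hU.mem_nhds hyU] with z hz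
      exact propext (mem_closure_iff_mem_closedSubgraph he hγc hU hDU hz)
    · have : y ∉ tsupport φ := fun h => hyU (hφU h)
      exact ((contDiffAt_const (c := (0 : ℝ))).congr_of_eventuallyEq
        (notMem_tsupport_iff_eventuallyEq.1 this)).contDiffWithinAt
  have hvol : ∫ y in D, fderiv ℝ φ y v = ∫ y in subgraph e γ, fderiv ℝ φ y v := by
    rw [← integral_indicator hD.measurableSet,
      ← integral_indicator (isOpen_subgraph hγc).measurableSet]
    congr 1
    refine indicator_eq_indicator_of_eq_zero_off hDU fun y hyU => ?_
    have h2 : fderiv ℝ φ y = 0 := by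
      by_contra h
      exact hyU (hφU (support_fderiv_subset ℝ h))
    simp [h2]
  set h : EuclideanSpace ℝ (Fin n) → ℝ := fun s => φ s * inner ℝ v (outwardNormal D s) with hh
  have hind : (frontier D).indicator h = (Set.range (graphMap e γ)).indicator h := by
    refine indicator_eq_indicator_of_eq_zero_off
      (fun y hyU => mem_frontier_iff_mem_range_graphMap he hγc hD hU hDU hyU) fun y hyU => ?_
    have h2 : φ y = 0 := by
      by_contra h
      exact hyU (hφU (subset_closure h))
    simp [hh, h2]
  have hrm : MeasurableSet (Set.range (graphMap e γ)) :=
    (measurableEmbedding_graphMap he hγ).measurableSet_range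
  have hfm : MeasurableSet (frontier D) := isClosed_frontier.measurableSet
  have hrank := finrank_perp he
  have hae : ∀ᵐ x : (ℝ ∙ e)ᗮ, √(1 + ‖gradient (restrictPerp e γ) x‖ ^ 2) * h (graphMap e γ x) =
      inner ℝ v (e - ((gradient (restrictPerp e γ) x : (ℝ ∙ e)ᗮ) : EuclideanSpace ℝ (Fin n))) *
        φ (graphMap e γ x) := by
    filter_upwards [(restrictPerp_lipschitzWith hγ).ae_differentiableAt (μ := volume)] with x hx
    by_cases hxU : graphMap e γ x ∈ U
    · have hν := (isOutwardUnitNormal_graphMap he hU hDU hxU hx).outwardNormal_eq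
      simp only [hh, hν, inner_smul_right]
      have : √(1 + ‖gradient (restrictPerp e γ) x‖ ^ 2) ≠ 0 :=
        (Real.sqrt_pos.2 (by positivity)).ne'
      field_simp
    · have h2 : φ (graphMap e γ x) = 0 := by
        by_contra h
        exact hxU (hφU (subset_closure h))
      simp [hh, h2]
  have hemb : IsClosedEmbedding (graphMap e γ) :=
    (graphMap_antilipschitzWith he).isClosedEmbedding
      (graphMap_lipschitzWith he hγ).uniformContinuous
  constructor
  · rw [surfaceMeasure, ← IntegrableOn, ← integrable_indicator_iff hfm, hind,
      integrable_indicator_iff hrm, ← hrank, integrableOn_graph_iff he hγ, integrable_congr hae]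
    have hcont : Continuous fun x => φ (graphMap e γ x) := by
      refine continuousOn_univ.1 (hφS.continuousOn.comp hemb.continuous.continuousOn fun x _ => ?_)
      exact (perp_add_smul_mem_closedSubgraph he x _).2 le_rfl
    have hcs : HasCompactSupport fun x => φ (graphMap e γ x) := hc.comp_isClosedEmbedding hemb
    have hint : Integrable fun x => φ (graphMap e γ x) := hcont.integrable_of_hasCompactSupport hcs
    refine hint.bdd_mul (c := ‖v‖ * (1 + K)) ?_ ?_
    · have := measurable_gradient_restrictPerp (e := e) (γ := γ)
      have h3 : Measurable fun x => e -
          ((gradient (restrictPerp e γ) x : (ℝ ∙ e)ᗮ) : EuclideanSpace ℝ (Fin n)) :=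
        measurable_const.sub (measurable_subtype_coe.comp this)
      exact (h3.const_inner (c := v)).aestronglyMeasurable
    · refine Eventually.of_forall fun x => (norm_inner_le_norm _ _).trans ?_
      gcongr
      refine (norm_sub_le _ _).trans ?_
      rw [he, Submodule.norm_coe]
      gcongr
      exact norm_gradient_restrictPerp_le hγ x
  · rw [hvol, setIntegral_subgraph_fderiv he hγ hφS hc, surfaceMeasure,
      ← integral_indicator hfm, hind, integral_indicator hrm, ← hrank, integral_graph he hγ]
    exact (integral_congr_ae hae).symm

end Gauss

section GlobalGauss

variable {n : ℕ} {D : Set (EuclideanSpace ℝ (Fin n))} {φ : EuclideanSpace ℝ (Fin n) → ℝ}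

lemma IsBoundedLipschitzDomain.isCompact_closure (hD : IsBoundedLipschitzDomain D) :
    IsCompact (closure D) := hD.isBounded.isCompact_closure

/-- The charts may be taken bounded, so that functions supported in them have compact support. -/
lemma IsBoundedLipschitzDomain.exists_chart (hD : IsBoundedLipschitzDomain D)
    {x : EuclideanSpace ℝ (Fin n)} (hx : x ∈ frontier D) :
    ∃ (e : EuclideanSpace ℝ (Fin n)) (K : ℝ≥0) (γ : EuclideanSpace ℝ (Fin n) → ℝ)
      (U : Set (EuclideanSpace ℝ (Fin n))), ‖e‖ = 1 ∧ LipschitzWith K γ ∧ IsOpen U ∧ x ∈ U ∧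
      Bornology.IsBounded U ∧ ∀ y ∈ U, (y ∈ D ↔ y ∈ subgraph e γ) := by
  obtain ⟨e, K, γ, U, he, hγ, hU, hxU, h⟩ := hD.locally_subgraph x hx
  exact ⟨e, K, γ, U ∩ Metric.ball x 1, he, hγ, hU.inter Metric.isOpen_ball,
    ⟨hxU, Metric.mem_ball_self one_pos⟩, Metric.isBounded_ball.subset Set.inter_subset_right,
    fun y hy => h y hy.1⟩

lemma IsBoundedLipschitzDomain.uniqueDiffOn_closure (hD : IsBoundedLipschitzDomain D) :
    UniqueDiffOn ℝ (closure D) := by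
  intro x hx
  by_cases hxD : x ∈ D
  · exact (hD.isOpen.uniqueDiffWithinAt hxD).mono subset_closure
  have hxf : x ∈ frontier D := by
    rw [hD.isOpen.frontier_eq]; exact ⟨hx, hxD⟩
  obtain ⟨e, K, γ, U, he, hγ, hU, hxU, -, hDU⟩ := hD.exists_chart hxf
  have h1 := (mem_frontier_iff_mem_range_graphMap he hγ.continuous hD.isOpen hU hDU hxU).1 hxf
  rw [range_graphMap he] at h1
  have h2 := (uniqueDiffWithinAt_subgraph he hγ h1).inter (hU.mem_nhds hxU)
  exact h2.mono fun y hy => subset_closure ((hDU y hy.2).2 hy.1)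

lemma fderivWithin_closure_eq (hD : IsOpen D) {x : EuclideanSpace ℝ (Fin n)} (hx : x ∈ D)
    {F : Type*} [NormedAddCommGroup F] [NormedSpace ℝ F] (g : EuclideanSpace ℝ (Fin n) → F) :
    fderivWithin ℝ g (closure D) x = fderiv ℝ g x :=
  fderivWithin_of_mem_nhds (mem_of_superset (hD.mem_nhds hx) subset_closure)

lemma IsBoundedLipschitzDomain.integrableOn_of_continuousOn (hD : IsBoundedLipschitzDomain D)
    (hφ : ContinuousOn φ (closure D)) : IntegrableOn φ D :=
  (hφ.integrableOn_compact hD.isCompact_closure).mono_set subset_closure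

lemma IsBoundedLipschitzDomain.integrableOn_fderiv (hD : IsBoundedLipschitzDomain D)
    (hφ : ContDiffOn ℝ 1 φ (closure D)) (v : EuclideanSpace ℝ (Fin n)) :
    IntegrableOn (fun y => fderiv ℝ φ y v) D := by
  have h1 : ContinuousOn (fun y => fderivWithin ℝ φ (closure D) y v) (closure D) :=
    (hφ.continuousOn_fderivWithin hD.uniqueDiffOn_closure le_rfl).clm_apply continuousOn_const
  refine (hD.integrableOn_of_continuousOn h1).congr_fun (fun y hy => ?_) hD.isOpen.measurableSet
  simp only [fderivWithin_closure_eq hD.isOpen hy]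

lemma integral_fderiv_eq_zero_of_hasCompactSupport (hφ : ContDiff ℝ 1 φ)
    (hc : HasCompactSupport φ) (v : EuclideanSpace ℝ (Fin n)) : ∫ y, fderiv ℝ φ y v = 0 := by
  have h1 : Integrable fun y => fderiv ℝ φ y v :=
    ((hφ.continuous_fderiv one_ne_zero).clm_apply continuous_const).integrable_of_hasCompactSupport
      ((hc.fderiv (𝕜 := ℝ)).mono fun x hx h => hx (by simp [h]))
  have h2 : Integrable φ := hφ.continuous.integrable_of_hasCompactSupport hc
  have h3 := integral_mul_fderiv_eq_neg_fderiv_mul_of_integrable (μ := volume)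
    (f := fun _ : EuclideanSpace ℝ (Fin n) => (1 : ℝ)) (g := φ) (v := v) (by simp)
    (by simpa using h1) (by simpa using h2) (fun _ _ => differentiableAt_const _)
    (fun x _ => hφ.differentiable one_ne_zero x)
  simpa using h3

/-- The divergence theorem for a function supported in the interior. -/
lemma gauss_of_tsupport_subset (hD : IsOpen D) (hφ : ContDiffOn ℝ 1 φ (closure D))
    (hc : HasCompactSupport φ) (hφD : tsupport φ ⊆ D) (v : EuclideanSpace ℝ (Fin n)) :
    Integrable (fun s => φ s * inner ℝ v (outwardNormal D s)) (surfaceMeasure D) ∧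
    ∫ y in D, fderiv ℝ φ y v = ∫ s, φ s * inner ℝ v (outwardNormal D s) ∂(surfaceMeasure D) := by
  have hsm : ContDiff ℝ 1 φ := by
    refine contDiff_iff_contDiffAt.2 fun x => ?_
    by_cases hx : x ∈ D
    · exact (hφ.mono subset_closure).contDiffAt (hD.mem_nhds hx)
    · exact (contDiffAt_const (c := (0 : ℝ))).congr_of_eventuallyEq
        (notMem_tsupport_iff_eventuallyEq.1 fun h => hx (hφD h))
  have h0 : (fun s => φ s * inner ℝ v (outwardNormal D s)) =ᵐ[surfaceMeasure D] 0 := by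
    filter_upwards [ae_restrict_mem isClosed_frontier.measurableSet] with s hs
    have : φ s = 0 := by
      by_contra h
      rw [hD.frontier_eq] at hs
      exact hs.2 (hφD (subset_closure h))
    simp [this]
  refine ⟨(integrable_zero _ _ _).congr h0.symm, ?_⟩
  rw [integral_congr_ae h0, setIntegral_eq_integral_of_forall_compl_eq_zero,
    integral_fderiv_eq_zero_of_hasCompactSupport hsm hc]
  · simp
  · intro x hx
    have h2 : fderiv ℝ φ x = 0 := by
      by_contra h
      exact hx (hφD (support_fderiv_subset ℝ h))
    simp [h2]

/-- The divergence theorem on a bounded Lipschitz domain, one derivative at a time. -/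
theorem IsBoundedLipschitzDomain.gauss (hD : IsBoundedLipschitzDomain D)
    (hφ : ContDiffOn ℝ 1 φ (closure D)) (v : EuclideanSpace ℝ (Fin n)) :
    Integrable (fun s => φ s * inner ℝ v (outwardNormal D s)) (surfaceMeasure D) ∧
    ∫ y in D, fderiv ℝ φ y v = ∫ s, φ s * inner ℝ v (outwardNormal D s) ∂(surfaceMeasure D) := by
  classical
  have hloc : ∀ x ∈ closure D, ∃ U : Set (EuclideanSpace ℝ (Fin n)), IsOpen U ∧ x ∈ U ∧
      ∀ ψ : EuclideanSpace ℝ (Fin n) → ℝ, ContDiffOn ℝ 1 ψ (closure D) → tsupport ψ ⊆ U →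
        Integrable (fun s => ψ s * inner ℝ v (outwardNormal D s)) (surfaceMeasure D) ∧
        ∫ y in D, fderiv ℝ ψ y v =
          ∫ s, ψ s * inner ℝ v (outwardNormal D s) ∂(surfaceMeasure D) := by
    intro x hx
    by_cases hxD : x ∈ D
    · refine ⟨D, hD.isOpen, hxD, fun ψ hψ hψD => gauss_of_tsupport_subset hD.isOpen hψ ?_ hψD v⟩
      exact Metric.isCompact_of_isClosed_isBounded (isClosed_tsupport _) (hD.isBounded.subset hψD)
    · have hxf : x ∈ frontier D := by
        rw [hD.isOpen.frontier_eq]; exact ⟨hx, hxD⟩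
      obtain ⟨e, K, γ, U, he, hγ, hU, hxU, hUb, hDU⟩ := hD.exists_chart hxf
      exact ⟨U, hU, hxU, fun ψ hψ hψU => gauss_of_tsupport_subset_chart hD.isOpen he hγ hU hDU hψ
        (Metric.isCompact_of_isClosed_isBounded (isClosed_tsupport _) (hUb.subset hψU)) hψU v⟩
  choose! U hUo hxU hU using hloc
  obtain ⟨t, htD, ht⟩ := hD.isCompact_closure.elim_nhds_subcover U
    fun x hx => (hUo x hx).mem_nhds (hxU x hx)
  obtain ⟨ρ, hρ⟩ := SmoothPartitionOfUnity.exists_isSubordinate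
    (modelWithCornersSelf ℝ (EuclideanSpace ℝ (Fin n))) (isClosed_closure (s := D))
    (fun i : t => U i) (fun i => hUo _ (htD _ i.2)) (by simpa [Set.iUnion_subtype] using ht)
  have hsum : ∀ x ∈ closure D, ∑ i, ρ i x = 1 := fun x hx => by
    rw [← finsum_eq_sum_of_fintype]; exact ρ.sum_eq_one hx
  set ψ : t → EuclideanSpace ℝ (Fin n) → ℝ := fun i x => ρ i x * φ x with hψ
  have hψs : ∀ i, ContDiffOn ℝ 1 (ψ i) (closure D) := fun i =>
    (((ρ i).contMDiff.contDiff.of_le (by simp)).contDiffOn).mul hφ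
  have hψU : ∀ i, tsupport (ψ i) ⊆ U i := fun i => (tsupport_mul_subset_left).trans (hρ i)
  have hg := fun i : t => hU _ (htD _ i.2) (ψ i) (hψs i) (hψU i)
  have hψφ : ∀ x ∈ closure D, ∑ i, ψ i x = φ x := fun x hx => by
    simp only [hψ, ← Finset.sum_mul, hsum x hx, one_mul]
  have hae : (fun s => ∑ i, ψ i s * inner ℝ v (outwardNormal D s)) =ᵐ[surfaceMeasure D]
      fun s => φ s * inner ℝ v (outwardNormal D s) := by
    filter_upwards [ae_restrict_mem isClosed_frontier.measurableSet] with s hs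
    rw [← Finset.sum_mul, hψφ s (frontier_subset_closure hs)]
  have hfd : ∀ y ∈ D, fderiv ℝ φ y v = ∑ i, fderiv ℝ (ψ i) y v := by
    intro y hy
    have h1 : φ =ᶠ[𝓝 y] fun x => ∑ i, ψ i x := by
      filter_upwards [hD.isOpen.mem_nhds hy] with x hx
      rw [hψφ x (subset_closure hx)]
    rw [h1.fderiv_eq, fderiv_fun_sum, sum_apply]
    intro i _
    exact (((hψs i).mono subset_closure).contDiffAt (hD.isOpen.mem_nhds hy)).differentiableAt
      one_ne_zero
  refine ⟨(integrable_finsetSum _ fun i _ => (hg i).1).congr hae, ?_⟩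
  rw [← integral_congr_ae hae, integral_finsetSum _ fun i _ => (hg i).1,
    setIntegral_congr_fun hD.isOpen.measurableSet hfd,
    integral_finsetSum _ fun i _ => hD.integrableOn_fderiv (hψs i) v]
  exact Finset.sum_congr rfl fun i _ => (hg i).2

lemma laplacian_eq_sum_fderiv (g : EuclideanSpace ℝ (Fin n) → ℝ) (x : EuclideanSpace ℝ (Fin n)) :
    Δ g x = ∑ i, fderiv ℝ (fderiv ℝ g) x (EuclideanSpace.single i 1)
      (EuclideanSpace.single i 1) := by
  rw [InnerProductSpace.laplacian_eq_iteratedFDeriv_orthonormalBasis g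
    (EuclideanSpace.basisFun (Fin n) ℝ)]
  simp [iteratedFDeriv_two_apply]

lemma IsBoundedLipschitzDomain.contDiffOn_fderivWithin_apply (hD : IsBoundedLipschitzDomain D)
    {g : EuclideanSpace ℝ (Fin n) → ℝ} (hg : ContDiffOn ℝ 2 g (closure D))
    (v : EuclideanSpace ℝ (Fin n)) :
    ContDiffOn ℝ 1 (fun x => fderivWithin ℝ g (closure D) x v) (closure D) :=
  (hg.fderivWithin hD.uniqueDiffOn_closure (m := 1) (by norm_num)).clm_apply contDiffOn_const

lemma hasFDerivAt_fderivWithin_closure_apply (hD : IsOpen D)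
    {g : EuclideanSpace ℝ (Fin n) → ℝ} (hg : ContDiffOn ℝ 2 g (closure D))
    {x : EuclideanSpace ℝ (Fin n)} (hx : x ∈ D) (v : EuclideanSpace ℝ (Fin n)) :
    HasFDerivAt (fun x => fderivWithin ℝ g (closure D) x v)
      ((fderiv ℝ (fderiv ℝ g) x).flip v) x := by
  have h1 : (fun x => fderivWithin ℝ g (closure D) x v) =ᶠ[𝓝 x] fun x => fderiv ℝ g x v := by
    filter_upwards [hD.mem_nhds hx] with y hy
    rw [fderivWithin_closure_eq hD hy]
  refine HasFDerivAt.congr_of_eventuallyEq ?_ h1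
  have h2 : DifferentiableAt ℝ (fderiv ℝ g) x :=
    (((hg.mono subset_closure).contDiffAt (hD.mem_nhds hx)).fderiv_right
      (m := 1) (by norm_num)).differentiableAt one_ne_zero
  have h3 := h2.hasFDerivAt.clm_apply (hasFDerivAt_const v x)
  simpa using h3

/-- The Laplacian of a function of class `C^2` up to the boundary extends continuously to it. -/
lemma IsBoundedLipschitzDomain.exists_continuousOn_eq_laplacian (hD : IsBoundedLipschitzDomain D)
    {g : EuclideanSpace ℝ (Fin n) → ℝ} (hg : ContDiffOn ℝ 2 g (closure D)) :
    ∃ h : EuclideanSpace ℝ (Fin n) → ℝ, ContinuousOn h (closure D) ∧ ∀ x ∈ D, Δ g x = h x := by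
  refine ⟨fun x => ∑ i : Fin n, fderivWithin ℝ (fun x => fderivWithin ℝ g (closure D) x
    (EuclideanSpace.single i 1)) (closure D) x (EuclideanSpace.single i 1), ?_, fun x hx => ?_⟩
  · refine continuousOn_finsetSum _ fun i _ => ?_
    exact ((hD.contDiffOn_fderivWithin_apply hg _).continuousOn_fderivWithin
      hD.uniqueDiffOn_closure le_rfl).clm_apply continuousOn_const
  · rw [laplacian_eq_sum_fderiv]
    refine Finset.sum_congr rfl fun i _ => ?_
    rw [fderivWithin_closure_eq hD.isOpen hx,
      (hasFDerivAt_fderivWithin_closure_apply hD.isOpen hg hx _).fderiv]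
    rfl

/-- Green's second identity on a bounded Lipschitz domain. -/
theorem IsBoundedLipschitzDomain.green (hD : IsBoundedLipschitzDomain D)
    {g h : EuclideanSpace ℝ (Fin n) → ℝ} (hg : ContDiffOn ℝ 2 g (closure D))
    (hh : ContDiffOn ℝ 2 h (closure D)) :
    Integrable (fun s => h s * normalDeriv D g s - g s * normalDeriv D h s) (surfaceMeasure D) ∧
    ∫ y in D, (h y * Δ g y - g y * Δ h y) =
      ∫ s, (h s * normalDeriv D g s - g s * normalDeriv D h s) ∂(surfaceMeasure D) := by
  set b : Fin n → EuclideanSpace ℝ (Fin n) := fun i => EuclideanSpace.single i 1 with hb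
  -- the divergence theorem for the components of the field `h ∇g - g ∇h`
  set F : Fin n → EuclideanSpace ℝ (Fin n) → ℝ := fun i x =>
    h x * fderivWithin ℝ g (closure D) x (b i) - g x * fderivWithin ℝ h (closure D) x (b i) with hF
  have hFs : ∀ i, ContDiffOn ℝ 1 (F i) (closure D) := fun i =>
    ((hh.of_le (by norm_num)).mul (hD.contDiffOn_fderivWithin_apply hg _)).sub
      ((hg.of_le (by norm_num)).mul (hD.contDiffOn_fderivWithin_apply hh _))
  have hG := fun i => hD.gauss (hFs i) (b i)
  have hdiff : ∀ {u : EuclideanSpace ℝ (Fin n) → ℝ}, ContDiffOn ℝ 2 u (closure D) →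
      ∀ y ∈ D, HasFDerivAt u (fderiv ℝ u y) y := fun hu y hy =>
    (((hu.mono subset_closure).contDiffAt (hD.isOpen.mem_nhds hy)).differentiableAt
      two_ne_zero).hasFDerivAt
  have hvol : ∀ y ∈ D, h y * Δ g y - g y * Δ h y = ∑ i, fderiv ℝ (F i) y (b i) := by
    intro y hy
    rw [laplacian_eq_sum_fderiv, laplacian_eq_sum_fderiv, Finset.mul_sum, Finset.mul_sum,
      ← Finset.sum_sub_distrib]
    refine Finset.sum_congr rfl fun i _ => ?_
    have h1 := ((hdiff hh y hy).mul
      (hasFDerivAt_fderivWithin_closure_apply hD.isOpen hg hy (b i))).sub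
      ((hdiff hg y hy).mul (hasFDerivAt_fderivWithin_closure_apply hD.isOpen hh hy (b i)))
    have h2 : fderiv ℝ (F i) y = _ := h1.fderiv
    rw [h2]
    simp only [sub_apply, add_apply, smul_apply, smul_eq_mul, ContinuousLinearMap.flip_apply,
      fderivWithin_closure_eq hD.isOpen hy]
    ring
  have hexp : ∀ (A : EuclideanSpace ℝ (Fin n) →L[ℝ] ℝ) (w : EuclideanSpace ℝ (Fin n)),
      A w = ∑ i, A (b i) * inner ℝ (b i) w := by
    intro A w
    conv_lhs => rw [← (EuclideanSpace.basisFun (Fin n) ℝ).sum_repr' w]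
    simp [hb, mul_comm]
  have hsurf : ∀ s, ∑ i, F i s * inner ℝ (b i) (outwardNormal D s) =
      h s * normalDeriv D g s - g s * normalDeriv D h s := by
    intro s
    rw [normalDeriv, normalDeriv, hexp (fderivWithin ℝ g (closure D) s),
      hexp (fderivWithin ℝ h (closure D) s), Finset.mul_sum, Finset.mul_sum,
      ← Finset.sum_sub_distrib]
    exact Finset.sum_congr rfl fun i _ => by simp only [hF]; ring
  simp_rw [← hsurf]
  refine ⟨integrable_finsetSum _ fun i _ => (hG i).1, ?_⟩
  rw [integral_finsetSum _ fun i _ => (hG i).1, setIntegral_congr_fun hD.isOpen.measurableSet hvol,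
    integral_finsetSum _ fun i _ => hD.integrableOn_fderiv (hFs i) _]
  exact Finset.sum_congr rfl fun i _ => (hG i).2

end GlobalGauss

/-! ### Iterated partial derivatives -/

section PartialDeriv

open scoped Convolution

variable {n : ℕ} {u v φ : EuclideanSpace ℝ (Fin n) → ℝ} {x : EuclideanSpace ℝ (Fin n)}
  {D : Set (EuclideanSpace ℝ (Fin n))}

lemma partialDeriv_congr {k : ℕ} (J : Fin k → Fin n) (h : u =ᶠ[𝓝 x] v) :
    partialDeriv J u =ᶠ[𝓝 x] partialDeriv J v := by
  filter_upwards [h.iteratedFDeriv ℝ k] with y hy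
  rw [partialDeriv, partialDeriv, hy]

lemma partialDeriv_zero_apply (J : Fin 0 → Fin n) : partialDeriv J u = u := by
  funext y
  rw [partialDeriv, iteratedFDeriv_zero_apply]

lemma partialDeriv_add {k : ℕ} (J : Fin k → Fin n) (hu : ContDiffAt ℝ k u x)
    (hv : ContDiffAt ℝ k v x) :
    partialDeriv J (fun y => u y + v y) x = partialDeriv J u x + partialDeriv J v x := by
  have h := iteratedFDeriv_add_apply hu hv
  simp only [partialDeriv]
  change iteratedFDeriv ℝ k (u + v) x _ = _
  rw [h]
  rfl

lemma ContDiffAt.partialDeriv {k m : ℕ} {N : WithTop ℕ∞} (J : Fin k → Fin n)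
    (hu : ContDiffAt ℝ N u x) (hN : ((m + k : ℕ) : WithTop ℕ∞) ≤ N) :
    ContDiffAt ℝ m (partialDeriv J u) x := by
  have h := hu.iteratedFDeriv_right (m := (m : WithTop ℕ∞)) (i := k) (by exact_mod_cast hN)
  exact (ContinuousMultilinearMap.apply ℝ (fun _ : Fin k => EuclideanSpace ℝ (Fin n)) ℝ
    (fun i => EuclideanSpace.single (J i) (1 : ℝ))).contDiff.contDiffAt.comp x h

lemma ContDiff.partialDeriv {k m : ℕ} {N : WithTop ℕ∞} (J : Fin k → Fin n)
    (hu : ContDiff ℝ N u) (hN : ((m + k : ℕ) : WithTop ℕ∞) ≤ N) :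
    ContDiff ℝ m (partialDeriv J u) :=
  contDiff_iff_contDiffAt.2 fun _ => hu.contDiffAt.partialDeriv J hN

lemma ContDiff.partialDeriv_infty {k : ℕ} (J : Fin k → Fin n) (hu : ContDiff ℝ ∞ u) :
    ContDiff ℝ ∞ (_root_.partialDeriv J u) :=
  contDiff_infty.2 fun _ => hu.partialDeriv J (by exact_mod_cast le_top)

lemma tsupport_partialDeriv_subset {k : ℕ} (J : Fin k → Fin n) :
    tsupport (partialDeriv J u) ⊆ tsupport u := by
  refine (closure_minimal (fun y hy => ?_) (isClosed_tsupport u))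
  by_contra h
  refine hy ?_
  have h1 : u =ᶠ[𝓝 y] fun _ => (0 : ℝ) := notMem_tsupport_iff_eventuallyEq.1 h
  rw [(partialDeriv_congr J h1).eq_of_nhds, partialDeriv]
  simp

/-- The first index is the outermost derivative. -/
lemma partialDeriv_succ {k : ℕ} (J : Fin (k + 1) → Fin n)
    (hu : ContDiffAt ℝ ((k + 1 : ℕ) : WithTop ℕ∞) u x) :
    partialDeriv J u x = fderiv ℝ (partialDeriv (Fin.tail J) u) x
      (EuclideanSpace.single (J 0) 1) := by
  have h : ContDiffAt ℝ (1 : ℕ) (iteratedFDeriv ℝ k u) x :=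
    hu.iteratedFDeriv_right (by norm_cast; rw [add_comm])
  have h1 := (h.differentiableAt (by norm_num)).hasFDerivAt
  have h2 := ((ContinuousMultilinearMap.apply ℝ (fun _ : Fin k => EuclideanSpace ℝ (Fin n)) ℝ
    (fun i => EuclideanSpace.single (Fin.tail J i) (1 : ℝ))).hasFDerivAt.comp x h1).fderiv
  have h3 : partialDeriv (Fin.tail J) u =
      (ContinuousMultilinearMap.apply ℝ (fun _ : Fin k => EuclideanSpace ℝ (Fin n)) ℝ
        (fun i => EuclideanSpace.single (Fin.tail J i) (1 : ℝ))) ∘ iteratedFDeriv ℝ k u := rfl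
  rw [h3, h2, partialDeriv, iteratedFDeriv_succ_apply_left]
  rfl

lemma fderiv_fderiv_apply_comm (hu : ContDiff ℝ ∞ u) (a b y : EuclideanSpace ℝ (Fin n)) :
    fderiv ℝ (fun z => fderiv ℝ u z b) y a = fderiv ℝ (fun z => fderiv ℝ u z a) y b := by
  have h1 : DifferentiableAt ℝ (fderiv ℝ u) y :=
    ((hu.fderiv_right (m := 1) (by norm_cast)).differentiable one_ne_zero) y
  have h2 : ∀ c : EuclideanSpace ℝ (Fin n), fderiv ℝ (fun z => fderiv ℝ u z c) y =
      (fderiv ℝ (fderiv ℝ u) y).flip c := by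
    intro c
    have := (h1.hasFDerivAt.clm_apply (hasFDerivAt_const c y)).fderiv
    simpa using this
  rw [h2, h2]
  exact (hu.contDiffAt.isSymmSndFDerivAt (by
    rw [minSmoothness_of_isRCLikeNormedField]; norm_cast)) a b

lemma ContDiff.fderiv_apply_infty (hu : ContDiff ℝ ∞ u) (b : EuclideanSpace ℝ (Fin n)) :
    ContDiff ℝ ∞ fun y => fderiv ℝ u y b :=
  (hu.fderiv_right (m := ∞) le_rfl).clm_apply contDiff_const

lemma partialDeriv_fderiv_comm {k : ℕ} (J : Fin k → Fin n) (hu : ContDiff ℝ ∞ u)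
    (b : EuclideanSpace ℝ (Fin n)) :
    partialDeriv J (fun y => fderiv ℝ u y b) = fun y => fderiv ℝ (partialDeriv J u) y b := by
  induction k with
  | zero => simp only [partialDeriv_zero_apply]
  | succ k ih =>
    funext y
    have hle : ((k + 1 : ℕ) : WithTop ℕ∞) ≤ ∞ := by exact_mod_cast le_top
    rw [partialDeriv_succ J ((hu.fderiv_apply_infty b).contDiffAt.of_le hle), ih]
    have h1 : partialDeriv J u = fun z => fderiv ℝ (partialDeriv (Fin.tail J) u) z
        (EuclideanSpace.single (J 0) 1) := by
      funext z
      exact partialDeriv_succ J (hu.contDiffAt.of_le hle)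
    rw [h1]
    exact fderiv_fderiv_apply_comm (hu.partialDeriv_infty _) _ _ _

/-- Repeated integration by parts against a compactly supported smooth function. -/
lemma integral_mul_partialDeriv {k : ℕ} (J : Fin k → Fin n) (hφ : ContDiff ℝ ∞ φ)
    (hc : HasCompactSupport φ) (hu : ContDiff ℝ k u) :
    ∫ y, φ y * partialDeriv J u y = (-1 : ℝ) ^ k * ∫ y, partialDeriv J φ y * u y := by
  induction k generalizing φ with
  | zero => simp [partialDeriv_zero_apply]
  | succ k ih =>
    have hle : ((k + 1 : ℕ) : WithTop ℕ∞) ≤ ∞ := by exact_mod_cast le_top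
    set b : EuclideanSpace ℝ (Fin n) := EuclideanSpace.single (J 0) 1 with hb
    set w := partialDeriv (Fin.tail J) u with hw
    have hws : ContDiff ℝ 1 w := by
      have := hu.partialDeriv (m := 1) (Fin.tail J) (by rw [add_comm])
      exact_mod_cast this
    have h1 : partialDeriv J u = fun z => fderiv ℝ w z b := by
      funext z
      exact partialDeriv_succ J hu.contDiffAt
    have h2 : partialDeriv J φ = partialDeriv (Fin.tail J) (fun y => fderiv ℝ φ y b) := by
      rw [partialDeriv_fderiv_comm _ hφ]
      funext z
      exact partialDeriv_succ J (hφ.contDiffAt.of_le hle)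
    have hφ' := hφ.fderiv_apply_infty b
    have hc' : HasCompactSupport fun y => fderiv ℝ φ y b :=
      (hc.fderiv (𝕜 := ℝ)).mono fun x hx h => hx (by simp [h])
    rw [h1, h2, pow_succ, mul_comm _ (-1 : ℝ), mul_assoc,
      ← ih (Fin.tail J) hφ' hc' (hu.of_le (by exact_mod_cast Nat.le_succ k))]
    rw [integral_mul_fderiv_eq_neg_fderiv_mul_of_integrable]
    · simp
      rfl
    · exact (hφ'.continuous.mul hws.continuous).integrable_of_hasCompactSupport hc'.mul_right
    · exact (hφ.continuous.mul ((hws.continuous_fderiv one_ne_zero).clm_apply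
        continuous_const)).integrable_of_hasCompactSupport hc.mul_right
    · exact (hφ.continuous.mul hws.continuous).integrable_of_hasCompactSupport hc.mul_right
    · exact fun x _ => hφ.differentiable (by simp) x
    · exact fun x _ => hws.differentiable one_ne_zero x

lemma laplacian_eq_sum_partialDeriv (g : EuclideanSpace ℝ (Fin n) → ℝ) :
    Δ g = fun x => ∑ i, partialDeriv ![i, i] g x := by
  rw [InnerProductSpace.laplacian_eq_iteratedFDeriv_orthonormalBasis g
    (EuclideanSpace.basisFun (Fin n) ℝ)]
  funext x
  refine Finset.sum_congr rfl fun i _ => ?_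
  rw [partialDeriv]
  congr 1
  funext j
  fin_cases j <;> simp

/-! ### Test functions and mollification -/

namespace IsTestFunction

lemma partialDeriv {k : ℕ} (J : Fin k → Fin n) (h : IsTestFunction D φ) :
    IsTestFunction D (partialDeriv J φ) where
  contDiff := h.contDiff.partialDeriv_infty J
  hasCompactSupport := h.hasCompactSupport.of_isClosed_subset (isClosed_tsupport _)
    (tsupport_partialDeriv_subset J)
  tsupport_subset := (tsupport_partialDeriv_subset J).trans h.tsupport_subset

lemma coeff_mul (hD : IsOpen D) {a : EuclideanSpace ℝ (Fin n) → ℝ}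
    (ha : ContDiffOn ℝ ∞ a (closure D)) (h : IsTestFunction D φ) :
    IsTestFunction D fun y => a y * φ y where
  contDiff := by
    simpa [mul_comm] using contDiff_mul_of_tsupport_subset h.contDiff hD h.tsupport_subset
      (ha.mono subset_closure)
  hasCompactSupport := h.hasCompactSupport.mul_left
  tsupport_subset := tsupport_mul_subset_right.trans h.tsupport_subset

lemma sum {ι : Type*} {s : Finset ι} {ψ : ι → EuclideanSpace ℝ (Fin n) → ℝ}
    (h : ∀ i ∈ s, IsTestFunction D (ψ i)) : IsTestFunction D fun y => ∑ i ∈ s, ψ i y := by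
  classical
  have hs : tsupport (fun y => ∑ i ∈ s, ψ i y) ⊆ ⋃ i ∈ s, tsupport (ψ i) := by
    refine closure_minimal (fun y hy => ?_)
      (isClosed_biUnion_finset fun i _ => isClosed_tsupport _)
    by_contra hcon
    refine hy (Finset.sum_eq_zero fun i hi => ?_)
    by_contra h0
    exact hcon (Set.mem_biUnion hi (subset_closure h0))
  exact {
    contDiff := ContDiff.sum fun i hi => (h i hi).contDiff
    hasCompactSupport := (s.isCompact_biUnion fun i hi =>
      (h i hi).hasCompactSupport).of_isClosed_subset (isClosed_tsupport _) hs
    tsupport_subset := hs.trans (Set.iUnion₂_subset fun i hi => (h i hi).tsupport_subset) }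

lemma const_mul (c : ℝ) (h : IsTestFunction D φ) : IsTestFunction D fun y => c * φ y where
  contDiff := contDiff_const.mul h.contDiff
  hasCompactSupport := h.hasCompactSupport.mul_left
  tsupport_subset := (tsupport_mul_subset_right (f := fun _ => c)).trans h.tsupport_subset

lemma laplacian (h : IsTestFunction D φ) : IsTestFunction D (Δ φ) := by
  rw [laplacian_eq_sum_partialDeriv]
  exact sum fun i _ => h.partialDeriv _

lemma eq_zero_of_notMem (h : IsTestFunction D φ) (hx : x ∉ D) : φ x = 0 := by
  by_contra h0
  exact hx (h.tsupport_subset (subset_closure h0))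

end IsTestFunction

lemma partialDeriv_convolution {k : ℕ} (J : Fin k → Fin n)
    (ρ : ContDiffBump (0 : EuclideanSpace ℝ (Fin n))) (hc : HasCompactSupport v)
    (hv : ContDiff ℝ k v) :
    partialDeriv J (ρ.normed volume ⋆[ContinuousLinearMap.lsmul ℝ ℝ, volume] v) =
      ρ.normed volume ⋆[ContinuousLinearMap.lsmul ℝ ℝ, volume] partialDeriv J v := by
  have hρ : ContDiff ℝ ∞ (ρ.normed volume) := ρ.contDiff_normed
  have hρl : LocallyIntegrable (ρ.normed volume) volume := hρ.continuous.locallyIntegrable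
  have hsm : ContDiff ℝ ∞ (ρ.normed volume ⋆[ContinuousLinearMap.lsmul ℝ ℝ, volume] v) :=
    ρ.hasCompactSupport_normed.contDiff_convolution_left (n := ⊤) _ hρ
      hv.continuous.locallyIntegrable
  induction k with
  | zero => simp only [partialDeriv_zero_apply]
  | succ k ih =>
    have hle : ((k + 1 : ℕ) : WithTop ℕ∞) ≤ ∞ := by exact_mod_cast le_top
    set w := partialDeriv (Fin.tail J) v with hw
    have hws : ContDiff ℝ 1 w := by
      have := hv.partialDeriv (m := 1) (Fin.tail J) (by rw [add_comm])
      exact_mod_cast this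
    have hwc : HasCompactSupport w :=
      hc.of_isClosed_subset (isClosed_tsupport _) (tsupport_partialDeriv_subset _)
    have h1 : partialDeriv J v = fun z => fderiv ℝ w z (EuclideanSpace.single (J 0) 1) := by
      funext z
      exact partialDeriv_succ J hv.contDiffAt
    funext z
    rw [partialDeriv_succ J (hsm.contDiffAt.of_le hle),
      ih (Fin.tail J) (hv.of_le (by exact_mod_cast Nat.le_succ k)),
      (hwc.hasFDerivAt_convolution_right (ContinuousLinearMap.lsmul ℝ ℝ) hρl hws z).fderiv,
      convolution_precompR_apply _ hρl (hwc.fderiv (𝕜 := ℝ))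
        (hws.continuous_fderiv one_ne_zero), h1]

/-- A compactly supported function of class `C^k` is a limit of test functions, uniformly with all
its partial derivatives up to order `k`. -/
lemma exists_testFunction_close {k : ℕ} (hD : IsOpen D) (hv : ContDiff ℝ k v)
    (hc : HasCompactSupport v) (hvD : tsupport v ⊆ D) {ε : ℝ} (hε : 0 < ε) :
    ∃ φ, IsTestFunction D φ ∧ ∀ j ≤ k, ∀ J : Fin j → Fin n, ∀ x,
      |partialDeriv J φ x - partialDeriv J v x| ≤ ε := by
  obtain ⟨δ₀, hδ₀, hδD⟩ := hc.isCompact.exists_cthickening_subset_open hD hvD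
  have huc : ∀ᶠ δ in 𝓝[>] (0 : ℝ), ∀ j ∈ Finset.range (k + 1), ∀ J : Fin j → Fin n,
      ∀ x y, dist y x < δ → dist (partialDeriv J v y) (partialDeriv J v x) ≤ ε := by
    refine (Filter.eventually_all_finset _).2 fun j hj => Filter.eventually_all.2 fun J => ?_
    have hjk : j ≤ k := Nat.lt_succ_iff.1 (Finset.mem_range.1 hj)
    have h1 : ContDiff ℝ (0 : ℕ) (partialDeriv J v) :=
      hv.partialDeriv J (by rw [zero_add]; exact_mod_cast hjk)
    have h2 : HasCompactSupport (partialDeriv J v) :=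
      hc.of_isClosed_subset (isClosed_tsupport _) (tsupport_partialDeriv_subset _)
    obtain ⟨δ, hδ, h3⟩ := Metric.uniformContinuous_iff.1
      (h2.uniformContinuous_of_continuous h1.continuous) ε hε
    filter_upwards [Ioo_mem_nhdsGT hδ] with δ' hδ' x y hxy
    exact (h3 (hxy.trans hδ'.2)).le
  obtain ⟨δ, hδ1, hδ2⟩ := (huc.and (Ioo_mem_nhdsGT hδ₀)).exists
  let ρ : ContDiffBump (0 : EuclideanSpace ℝ (Fin n)) :=
    ⟨δ / 2, δ, half_pos hδ2.1, half_lt_self hδ2.1⟩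
  have hρ : ContDiff ℝ ∞ (ρ.normed volume) := ρ.contDiff_normed
  refine ⟨ρ.normed volume ⋆[ContinuousLinearMap.lsmul ℝ ℝ, volume] v, ⟨?_, ?_, ?_⟩, ?_⟩
  · exact ρ.hasCompactSupport_normed.contDiff_convolution_left (n := ⊤) _ hρ
      hv.continuous.locallyIntegrable
  · exact ρ.hasCompactSupport_normed.convolution _ hc
  · refine Set.Subset.trans ?_ hδD
    refine closure_minimal (fun y hy => ?_) Metric.isClosed_cthickening
    obtain ⟨a, ha, b, hb, rfl⟩ := support_convolution_subset _ hy
    rw [ρ.support_normed_eq, mem_ball_zero_iff] at ha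
    refine Metric.mem_cthickening_of_dist_le (a + b) b δ₀ _ (subset_closure hb) ?_
    rw [dist_eq_norm, add_sub_cancel_right]
    exact (ha.trans hδ2.2).le
  · intro j hj J x
    rw [partialDeriv_convolution J ρ hc (hv.of_le (by exact_mod_cast hj)), ← Real.dist_eq]
    have h1 : ContDiff ℝ (0 : ℕ) (partialDeriv J v) :=
      hv.partialDeriv J (by rw [zero_add]; exact_mod_cast hj)
    exact ContDiffBump.dist_normed_convolution_le h1.continuous.aestronglyMeasurable
      fun y hy => hδ1 j (Finset.mem_range.2 (Nat.lt_succ_iff.2 hj)) J x y hy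

end PartialDeriv

/-! ### The differential operator and its transpose -/

namespace LinearPDO

variable {n p : ℕ} {D : Set (EuclideanSpace ℝ (Fin n))} {L : LinearPDO D p}
  {φ u v : EuclideanSpace ℝ (Fin n) → ℝ} {x : EuclideanSpace ℝ (Fin n)}

lemma apply_congr (h : u =ᶠ[𝓝 x] v) : L.apply u x = L.apply v x := by
  simp only [LinearPDO.apply, (partialDeriv_congr _ h).eq_of_nhds]

lemma apply_add (hu : ContDiffAt ℝ p u x) (hv : ContDiffAt ℝ p v x) :
    L.apply (fun y => u y + v y) x = L.apply u x + L.apply v x := by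
  simp only [LinearPDO.apply, ← Finset.sum_add_distrib]
  refine Finset.sum_congr rfl fun k hk => Finset.sum_congr rfl fun J _ => ?_
  have hkp : (k : WithTop ℕ∞) ≤ p := by
    exact_mod_cast Nat.lt_succ_iff.1 (Finset.mem_range.1 hk)
  rw [partialDeriv_add J (hu.of_le hkp) (hv.of_le hkp), mul_add]

lemma apply_eq_zero_of_eventuallyEq_zero (h : u =ᶠ[𝓝 x] fun _ => 0) : L.apply u x = 0 := by
  rw [apply_congr h, LinearPDO.apply]
  refine Finset.sum_eq_zero fun k _ => Finset.sum_eq_zero fun J _ => ?_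
  simp [partialDeriv]

lemma continuousOn_apply {O : Set (EuclideanSpace ℝ (Fin n))} (hO : IsOpen O)
    (hOD : O ⊆ closure D) (hu : ContDiffOn ℝ p u O) : ContinuousOn (L.apply u) O := by
  refine continuousOn_finsetSum _ fun k hk => continuousOn_finsetSum _ fun J _ => ?_
  have hkp : k ≤ p := Nat.lt_succ_iff.1 (Finset.mem_range.1 hk)
  refine ((L.smooth k hkp J).continuousOn.mono hOD).mul fun y hy => ?_
  exact ((hu.contDiffAt (hO.mem_nhds hy)).partialDeriv (m := 0) J
    (by rw [zero_add]; exact_mod_cast hkp)).continuousAt.continuousWithinAt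

lemma isTestFunction_apply (hD : IsOpen D) (hφ : IsTestFunction D φ) :
    IsTestFunction D (L.apply φ) :=
  IsTestFunction.sum fun k hk => IsTestFunction.sum fun J _ =>
    (hφ.partialDeriv J).coeff_mul hD
      (L.smooth k (Nat.lt_succ_iff.1 (Finset.mem_range.1 hk)) J)

lemma isTestFunction_transpose (hD : IsOpen D) (hφ : IsTestFunction D φ) :
    IsTestFunction D (L.transpose φ) :=
  IsTestFunction.sum fun k hk => IsTestFunction.sum fun J _ =>
    ((hφ.coeff_mul hD (L.smooth k (Nat.lt_succ_iff.1 (Finset.mem_range.1 hk)) J)).partialDeriv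
      J).const_mul _

lemma setIntegral_eq_integral_of_testFunction (hφ : IsTestFunction D φ)
    (w : EuclideanSpace ℝ (Fin n) → ℝ) : ∫ x in D, φ x * w x = ∫ x, φ x * w x :=
  setIntegral_eq_integral_of_forall_compl_eq_zero fun x hx => by
    rw [hφ.eq_zero_of_notMem hx, zero_mul]

lemma integrable_testFunction_mul (hφ : IsTestFunction D φ)
    {w : EuclideanSpace ℝ (Fin n) → ℝ} (hw : Continuous w) : Integrable fun x => φ x * w x :=
  (hφ.contDiff.continuous.mul hw).integrable_of_hasCompactSupport hφ.hasCompactSupport.mul_right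

lemma integral_mul_apply_of_contDiff (hD : IsOpen D) (hφ : IsTestFunction D φ)
    (hu : ContDiff ℝ p u) : ∫ x in D, φ x * L.apply u x = ∫ x in D, L.transpose φ x * u x := by
  rw [setIntegral_eq_integral_of_testFunction hφ,
    setIntegral_eq_integral_of_testFunction (isTestFunction_transpose hD hφ)]
  simp only [LinearPDO.apply, LinearPDO.transpose, Finset.mul_sum, Finset.sum_mul]
  have hle : ∀ k ∈ Finset.range (p + 1), k ≤ p := fun k hk =>
    Nat.lt_succ_iff.1 (Finset.mem_range.1 hk)
  have hcoeff : ∀ k ∈ Finset.range (p + 1), ∀ J : Fin k → Fin n,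
      IsTestFunction D fun y => L.coeff k J y * φ y := fun k hk J =>
    hφ.coeff_mul hD (L.smooth k (hle k hk) J)
  have hcont : ∀ k ∈ Finset.range (p + 1), ∀ J : Fin k → Fin n,
      Continuous (partialDeriv J u) := fun k hk J =>
    (hu.partialDeriv (m := 0) J (by rw [zero_add]; exact_mod_cast hle k hk)).continuous
  have h1 : ∀ k ∈ Finset.range (p + 1), ∀ J : Fin k → Fin n,
      Integrable fun x => φ x * (L.coeff k J x * partialDeriv J u x) := fun k hk J =>
    (integrable_testFunction_mul (hcoeff k hk J) (hcont k hk J)).congr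
      (Eventually.of_forall fun x => by ring)
  have h2 : ∀ k ∈ Finset.range (p + 1), ∀ J : Fin k → Fin n,
      Integrable fun x => (-1 : ℝ) ^ k * partialDeriv J (fun y => L.coeff k J y * φ y) x * u x :=
    fun k hk J => integrable_testFunction_mul
      (((hcoeff k hk J).partialDeriv J).const_mul _) hu.continuous
  rw [integral_finsetSum _ fun k hk => integrable_finsetSum _ fun J _ => h1 k hk J,
    integral_finsetSum _ fun k hk => integrable_finsetSum _ fun J _ => h2 k hk J]
  refine Finset.sum_congr rfl fun k hk => ?_
  rw [integral_finsetSum _ fun J _ => h1 k hk J, integral_finsetSum _ fun J _ => h2 k hk J]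
  refine Finset.sum_congr rfl fun J _ => ?_
  have h3 := integral_mul_partialDeriv J (hcoeff k hk J).contDiff
    (hcoeff k hk J).hasCompactSupport (hu.of_le (by exact_mod_cast hle k hk))
  simp_rw [mul_assoc]
  rw [integral_const_mul, ← h3]
  exact integral_congr_ae (Eventually.of_forall fun x => by ring)

/-- Integration by parts against a function which is smooth near the support of the test
function. -/
lemma integral_mul_apply (hD : IsOpen D) (hφ : IsTestFunction D φ)
    {O : Set (EuclideanSpace ℝ (Fin n))} (hO : IsOpen O) (hφO : tsupport φ ⊆ O)
    (hu : ContDiffOn ℝ p u O) : ∫ x in D, φ x * L.apply u x = ∫ x in D, L.transpose φ x * u x := by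
  obtain ⟨η, hη, -, hηO, hη1⟩ := exists_contDiff_cutoff hφ.hasCompactSupport.isCompact hO hφO
  have hs : ContDiff ℝ p fun x => η x * u x :=
    contDiff_mul_of_tsupport_subset (hη.of_le (by exact_mod_cast le_top)) hO hηO hu
  have h := integral_mul_apply_of_contDiff (L := L) hD hφ hs
  have hη' : ∀ x ∈ tsupport φ, (fun y => η y * u y) =ᶠ[𝓝 x] u := fun x hx => by
    filter_upwards [hη1 x hx] with y hy
    rw [hy, one_mul]
  have hT : ∀ x ∉ tsupport φ, L.transpose φ x = 0 := by
    intro x hx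
    have h0 := notMem_tsupport_iff_eventuallyEq.1 hx
    refine Finset.sum_eq_zero fun k _ => Finset.sum_eq_zero fun J _ => ?_
    have h1 : (fun y => L.coeff k J y * φ y) =ᶠ[𝓝 x] fun _ => 0 := by
      filter_upwards [h0] with y hy
      simp [hy]
    rw [(partialDeriv_congr J h1).eq_of_nhds, partialDeriv]
    simp
  have e1 : (fun x => φ x * L.apply u x) = fun x => φ x * L.apply (fun y => η y * u y) x := by
    funext x
    by_cases hx : x ∈ tsupport φ
    · rw [apply_congr (hη' x hx)]
    · rw [image_eq_zero_of_notMem_tsupport hx, zero_mul, zero_mul]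
  have e2 : (fun x => L.transpose φ x * u x) = fun x => L.transpose φ x * (η x * u x) := by
    funext x
    by_cases hx : x ∈ tsupport φ
    · exact congrArg _ (hη' x hx).eq_of_nhds.symm
    · rw [hT x hx, zero_mul, zero_mul]
  rw [e1, e2, h]

/-- The fundamental lemma of the calculus of variations for continuous functions. -/
lemma eq_zero_of_forall_testFunction {O : Set (EuclideanSpace ℝ (Fin n))} (hO : IsOpen O)
    {w : EuclideanSpace ℝ (Fin n) → ℝ} (hw : ContinuousOn w O)
    (h : ∀ ψ, IsTestFunction O ψ → ∫ x, ψ x * w x = 0) : ∀ x ∈ O, w x = 0 := by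
  have h1 := hO.ae_eq_zero_of_integral_contDiff_smul_eq_zero (μ := volume)
    (hw.locallyIntegrableOn hO.measurableSet) (fun g hg hgc hgs => h g ⟨hg, hgc, hgs⟩)
  have h2 : w =ᵐ[volume.restrict O] fun _ => (0 : ℝ) := (ae_restrict_iff' hO.measurableSet).2 h1
  exact Measure.eqOn_open_of_ae_eq h2 hO hw continuousOn_const

lemma testFunction_boundary (hD : IsOpen D) (hφ : IsTestFunction D φ) :
    ∀ x ∈ frontier D, φ x = 0 := fun x hx => hφ.eq_zero_of_notMem (by
  rw [hD.frontier_eq] at hx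
  exact hx.2)

/-- A self-adjoint operator is its own formal transpose. -/
lemma IsSelfAdjoint.transpose_eq (hL : L.IsSelfAdjoint) (hD : IsOpen D)
    (hφ : IsTestFunction D φ) : L.transpose φ = L.apply φ := by
  have hA := isTestFunction_apply (L := L) hD hφ
  have hT := isTestFunction_transpose (L := L) hD hφ
  have hle : (p : WithTop ℕ∞) ≤ ∞ := by exact_mod_cast le_top
  have key : ∀ x ∈ D, L.transpose φ x - L.apply φ x = 0 := by
    refine eq_zero_of_forall_testFunction hD
      (hT.contDiff.continuous.sub hA.contDiff.continuous).continuousOn fun ψ hψ => ?_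
    have h1 := hL φ ψ (hφ.contDiff.of_le hle).contDiffOn (hψ.contDiff.of_le hle).contDiffOn
      (testFunction_boundary hD hφ) (testFunction_boundary hD hψ)
    have h2 := integral_mul_apply_of_contDiff (L := L) hD hφ (hψ.contDiff.of_le hle)
    rw [h2, setIntegral_eq_integral_of_testFunction hA,
      setIntegral_eq_integral_of_testFunction hT] at h1
    have h3 : ∫ x, ψ x * (L.transpose φ x - L.apply φ x) =
        ∫ x, (L.transpose φ x * ψ x - L.apply φ x * ψ x) :=
      integral_congr_ae (Eventually.of_forall fun x => by ring)
    rw [h3, integral_sub (integrable_testFunction_mul hT hψ.contDiff.continuous)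
      (integrable_testFunction_mul hA hψ.contDiff.continuous), h1, sub_self]
  funext x
  by_cases hx : x ∈ D
  · exact sub_eq_zero.1 (key x hx)
  · rw [hT.eq_zero_of_notMem hx, hA.eq_zero_of_notMem hx]

/-! ### The Laplacian of a generalized Green's function -/

variable {t G : EuclideanSpace ℝ (Fin n) → EuclideanSpace ℝ (Fin n) → ℝ}
  {ξ : EuclideanSpace ℝ (Fin n)}

/-- `L Δ G(·, ξ) = δ_ξ` in the sense of distributions: `L` commutes with the Laplacian, and
`Δ t(·, ξ) = δ_ξ`. -/
lemma IsGeneralizedGreen.integral_laplacian_mul_apply (hG : L.IsGeneralizedGreen t G)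
    (hL : L.IsSelfAdjoint) (hcomm : L.CommutesWithLaplacian) (hD : IsOpen D) (hξ : ξ ∈ D)
    (hφ : IsTestFunction D φ) :
    ∫ r in D, Δ (fun r => G r ξ) r * L.apply φ r = φ ξ := by
  rw [← hG.weak_laplacian ξ hξ _ (isTestFunction_apply hD hφ), ← hG.laplacian_t ξ hξ φ hφ,
    ← hG.equation ξ hξ _ hφ.laplacian, hL.transpose_eq hD hφ.laplacian]
  exact setIntegral_congr_fun hD.measurableSet fun r hr => by
    simp only [hcomm φ hφ.contDiff r hr]

lemma contDiffOn_laplacian_of_isOpen {g : EuclideanSpace ℝ (Fin n) → ℝ}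
    {O : Set (EuclideanSpace ℝ (Fin n))} (hO : IsOpen O)
    (hg : ContDiffOn ℝ ((p + 2 : ℕ) : WithTop ℕ∞) g O) : ContDiffOn ℝ p (Δ g) O := by
  rw [laplacian_eq_sum_partialDeriv]
  exact ContDiffOn.sum fun i _ x hx =>
    ((hg.contDiffAt (hO.mem_nhds hx)).partialDeriv _ le_rfl).contDiffWithinAt

lemma IsGeneralizedGreen.contDiffOn_punctured (hG : L.IsGeneralizedGreen t G) (hξ : ξ ∈ D) :
    ContDiffOn ℝ ((p + 2 : ℕ) : WithTop ℕ∞) (fun r => G r ξ) (D \ {ξ}) :=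
  (hG.contDiffOn ξ hξ).mono (Set.sdiff_subset_sdiff_left subset_closure)

/-- Away from the source point, `L Δ G(·, ξ)` vanishes in the classical sense. -/
lemma IsGeneralizedGreen.apply_laplacian_eq_zero (hG : L.IsGeneralizedGreen t G)
    (hL : L.IsSelfAdjoint) (hcomm : L.CommutesWithLaplacian) (hD : IsOpen D) (hξ : ξ ∈ D) :
    ∀ x ∈ D \ {ξ}, L.apply (Δ fun r => G r ξ) x = 0 := by
  have hO : IsOpen (D \ {ξ}) := hD.sdiff isClosed_singleton
  have hW := contDiffOn_laplacian_of_isOpen hO (hG.contDiffOn_punctured hξ)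
  refine eq_zero_of_forall_testFunction hO
    (continuousOn_apply hO (Set.sdiff_subset.trans subset_closure) hW) fun ψ hψ => ?_
  have hψD : IsTestFunction D ψ :=
    ⟨hψ.contDiff, hψ.hasCompactSupport, hψ.tsupport_subset.trans Set.sdiff_subset⟩
  rw [← setIntegral_eq_integral_of_testFunction hψD,
    integral_mul_apply hD hψD hO hψ.tsupport_subset hW, hL.transpose_eq hD hψD]
  have h1 := hG.integral_laplacian_mul_apply hL hcomm hD hξ hψD
  rw [hψ.eq_zero_of_notMem (x := ξ) (by simp)] at h1
  rw [← h1]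
  exact integral_congr_ae (Eventually.of_forall fun x => mul_comm _ _)

end LinearPDO

/-! ### The representation formula -/

namespace LinearPDO

variable {n p : ℕ} {D : Set (EuclideanSpace ℝ (Fin n))} {L : LinearPDO D p}
  {φ u v f : EuclideanSpace ℝ (Fin n) → ℝ} {x : EuclideanSpace ℝ (Fin n)}
  {t G : EuclideanSpace ℝ (Fin n) → EuclideanSpace ℝ (Fin n) → ℝ}
  {ξ : EuclideanSpace ℝ (Fin n)}

/-- Two functionals of order at most `k` that agree on test functions agree on compactly supported
functions of class `C^k`. -/
lemma eq_of_forall_testFunction {k : ℕ} (hD : IsOpen D) (hv : ContDiff ℝ k v)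
    (hc : HasCompactSupport v) (hvD : tsupport v ⊆ D)
    {A B : (EuclideanSpace ℝ (Fin n) → ℝ) → ℝ} {a b : ℝ}
    (hA : ∀ φ, IsTestFunction D φ → ∀ ε > 0, (∀ j ≤ k, ∀ J : Fin j → Fin n, ∀ x,
      |partialDeriv J φ x - partialDeriv J v x| ≤ ε) → |A φ - A v| ≤ a * ε)
    (hB : ∀ φ, IsTestFunction D φ → ∀ ε > 0, (∀ j ≤ k, ∀ J : Fin j → Fin n, ∀ x,
      |partialDeriv J φ x - partialDeriv J v x| ≤ ε) → |B φ - B v| ≤ b * ε)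
    (hAB : ∀ φ, IsTestFunction D φ → A φ = B φ) : A v = B v := by
  have h1 : ∀ ε > 0, |A v - B v| ≤ (a + b) * ε := by
    intro ε hε
    obtain ⟨φ, hφ, hclose⟩ := exists_testFunction_close hD hv hc hvD hε
    have h2 := hA φ hφ ε hε hclose
    have h3 := hB φ hφ ε hε hclose
    have h4 : A v - B v = (B φ - B v) - (A φ - A v) := by rw [hAB φ hφ]; ring
    rw [h4]
    have := abs_sub (B φ - B v) (A φ - A v)
    linarith
  have h5 : Tendsto (fun ε : ℝ => (a + b) * ε) (𝓝[>] 0) (𝓝 0) := by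
    have : Continuous fun ε : ℝ => (a + b) * ε := by fun_prop
    simpa using (this.tendsto 0).mono_left nhdsWithin_le_nhds
  have h6 : |A v - B v| ≤ 0 :=
    ge_of_tendsto h5 (by filter_upwards [self_mem_nhdsWithin] with ε hε using h1 ε hε)
  exact sub_eq_zero.1 (abs_nonpos_iff.1 h6)

lemma integrableOn_mul_continuousOn (hDo : IsOpen D) (hDc : IsCompact (closure D))
    {h F : EuclideanSpace ℝ (Fin n) → ℝ} (hh : IntegrableOn h D) (hF : ContinuousOn F (closure D)) :
    IntegrableOn (fun x => h x * F x) D :=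
  hh.mul_continuousOn_of_subset hF hDo.measurableSet hDc subset_closure

lemma abs_setIntegral_mul_sub_le (hDo : IsOpen D) (hDc : IsCompact (closure D))
    {h F₁ F₂ : EuclideanSpace ℝ (Fin n) → ℝ} (hh : IntegrableOn h D)
    (hF₁ : ContinuousOn F₁ (closure D)) (hF₂ : ContinuousOn F₂ (closure D)) {c : ℝ}
    (hc : ∀ x ∈ D, |F₁ x - F₂ x| ≤ c) :
    |(∫ x in D, h x * F₁ x) - ∫ x in D, h x * F₂ x| ≤ (∫ x in D, |h x|) * c := by
  rw [← integral_sub (integrableOn_mul_continuousOn hDo hDc hh hF₁)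
    (integrableOn_mul_continuousOn hDo hDc hh hF₂), ← integral_mul_const, ← Real.norm_eq_abs]
  refine norm_integral_le_of_norm_le (hh.abs.mul_const c) ?_
  filter_upwards [ae_restrict_mem hDo.measurableSet] with x hx
  rw [← mul_sub, norm_mul, Real.norm_eq_abs, Real.norm_eq_abs]
  exact mul_le_mul_of_nonneg_left (hc x hx) (abs_nonneg _)

lemma continuousOn_closure_apply (hv : ContDiff ℝ p v) : ContinuousOn (L.apply v) (closure D) := by
  refine continuousOn_finsetSum _ fun k hk => continuousOn_finsetSum _ fun J _ => ?_
  have hkp : k ≤ p := Nat.lt_succ_iff.1 (Finset.mem_range.1 hk)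
  exact (L.smooth k hkp J).continuousOn.mul (hv.partialDeriv (m := 0) J
    (by rw [zero_add]; exact_mod_cast hkp)).continuous.continuousOn

/-- `L` is continuous from `C^p` to uniform convergence on `D`. -/
lemma exists_abs_apply_sub_le (L : LinearPDO D p) (hDc : IsCompact (closure D)) :
    ∃ C : ℝ, ∀ (φ v : EuclideanSpace ℝ (Fin n) → ℝ) (ε : ℝ), 0 < ε →
      (∀ j ≤ p, ∀ J : Fin j → Fin n, ∀ x, |partialDeriv J φ x - partialDeriv J v x| ≤ ε) →
      ∀ x ∈ D, |L.apply φ x - L.apply v x| ≤ C * ε := by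
  have h1 : ∀ k (J : Fin k → Fin n), ∃ M : ℝ, k ≤ p → ∀ x ∈ closure D, ‖L.coeff k J x‖ ≤ M := by
    intro k J
    by_cases hk : k ≤ p
    · obtain ⟨M, hM⟩ := hDc.exists_bound_of_continuousOn (L.smooth k hk J).continuousOn
      exact ⟨M, fun _ => hM⟩
    · exact ⟨0, fun h => absurd h hk⟩
  choose M hM using h1
  refine ⟨∑ k ∈ Finset.range (p + 1), ∑ J : Fin k → Fin n, M k J, fun φ v ε hε hclose x hx => ?_⟩
  simp only [LinearPDO.apply, ← Finset.sum_sub_distrib, Finset.sum_mul]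
  refine (Finset.abs_sum_le_sum_abs _ _).trans (Finset.sum_le_sum fun k hk => ?_)
  refine (Finset.abs_sum_le_sum_abs _ _).trans (Finset.sum_le_sum fun J _ => ?_)
  have hkp : k ≤ p := Nat.lt_succ_iff.1 (Finset.mem_range.1 hk)
  rw [← mul_sub, abs_mul]
  have h2 := hM k J hkp x (subset_closure hx)
  exact mul_le_mul h2 (hclose k hkp J x) (abs_nonneg _) ((norm_nonneg _).trans h2)

/-- `L Δ G(·, ξ) = δ_ξ`, tested against compactly supported functions of class `C^p`. -/
lemma IsGeneralizedGreen.integral_laplacian_mul_apply_of_contDiff (hG : L.IsGeneralizedGreen t G)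
    (hL : L.IsSelfAdjoint) (hcomm : L.CommutesWithLaplacian) (hD : IsOpen D)
    (hDc : IsCompact (closure D)) (hξ : ξ ∈ D) (hv : ContDiff ℝ p v) (hc : HasCompactSupport v)
    (hvD : tsupport v ⊆ D) :
    ∫ r in D, Δ (fun r => G r ξ) r * L.apply v r = v ξ := by
  obtain ⟨C, hC⟩ := L.exists_abs_apply_sub_le hDc
  have hle : (p : WithTop ℕ∞) ≤ ∞ := by exact_mod_cast le_top
  refine eq_of_forall_testFunction hD hv hc hvD
    (A := fun w => ∫ r in D, Δ (fun r => G r ξ) r * L.apply w r) (B := fun w => w ξ)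
    (a := (∫ r in D, |Δ (fun r => G r ξ) r|) * C) (b := 1) (fun φ hφ ε hε hclose => ?_)
    (fun φ hφ ε hε hclose => ?_)
    fun φ hφ => hG.integral_laplacian_mul_apply hL hcomm hD hξ hφ
  · rw [mul_assoc]
    exact abs_setIntegral_mul_sub_le hD hDc (hG.laplacian_integrableOn ξ hξ)
      (continuousOn_closure_apply (hφ.contDiff.of_le hle)) (continuousOn_closure_apply hv)
      (hC φ v ε hε hclose)
  · have h := hclose 0 (Nat.zero_le p) Fin.elim0 ξ
    rw [partialDeriv_zero_apply, partialDeriv_zero_apply] at h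
    simpa using h

lemma continuous_laplacian (hv : ContDiff ℝ 2 v) : Continuous (Δ v) := by
  rw [laplacian_eq_sum_partialDeriv]
  exact continuous_finsetSum _ fun i _ =>
    (hv.partialDeriv (m := 0) ![i, i] (by norm_num)).continuous

/-- The distributional Laplacian, tested against compactly supported functions of class `C^2`. -/
lemma IsGeneralizedGreen.weak_laplacian_of_contDiff (hG : L.IsGeneralizedGreen t G)
    (hD : IsOpen D) (hDc : IsCompact (closure D)) (hξ : ξ ∈ D) (hv : ContDiff ℝ 2 v)
    (hc : HasCompactSupport v) (hvD : tsupport v ⊆ D) :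
    ∫ r in D, G r ξ * Δ v r = ∫ r in D, Δ (fun r => G r ξ) r * v r := by
  refine eq_of_forall_testFunction (k := 2) hD (by exact_mod_cast hv) hc hvD
    (A := fun w => ∫ r in D, G r ξ * Δ w r)
    (B := fun w => ∫ r in D, Δ (fun r => G r ξ) r * w r)
    (a := (∫ r in D, |G r ξ|) * n) (b := ∫ r in D, |Δ (fun r => G r ξ) r|)
    (fun φ hφ ε hε hclose => ?_) (fun φ hφ ε hε hclose => ?_) (hG.weak_laplacian ξ hξ)
  · rw [mul_assoc]
    refine abs_setIntegral_mul_sub_le hD hDc (hG.integrableOn ξ hξ)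
      hφ.laplacian.contDiff.continuous.continuousOn (continuous_laplacian hv).continuousOn
      fun x _ => ?_
    simp only [laplacian_eq_sum_partialDeriv, ← Finset.sum_sub_distrib]
    refine (Finset.abs_sum_le_sum_abs _ _).trans ?_
    refine (Finset.sum_le_sum fun i _ => hclose 2 le_rfl ![i, i] x).trans ?_
    simp
  · refine abs_setIntegral_mul_sub_le hD hDc (hG.laplacian_integrableOn ξ hξ)
      hφ.contDiff.continuous.continuousOn hv.continuous.continuousOn fun x _ => ?_
    have h := hclose 0 (Nat.zero_le 2) Fin.elim0 x
    rwa [partialDeriv_zero_apply, partialDeriv_zero_apply] at h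

lemma laplacianWithin_closure_eq (hD : IsOpen D) (hu : UniqueDiffOn ℝ (closure D)) (hx : x ∈ D)
    (g : EuclideanSpace ℝ (Fin n) → ℝ) : (Δ[closure D] g) x = Δ g x := by
  rw [InnerProductSpace.laplacianWithin_eq_iteratedFDerivWithin_stdOrthonormalBasis g hu
    (subset_closure hx), InnerProductSpace.laplacian_eq_iteratedFDeriv_stdOrthonormalBasis]
  have h : closure D =ᶠ[𝓝 x] (Set.univ : Set (EuclideanSpace ℝ (Fin n))) := by
    filter_upwards [hD.mem_nhds hx] with y hy
    exact propext ⟨fun _ => trivial, fun _ => subset_closure hy⟩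
  rw [iteratedFDerivWithin_congr_set h, iteratedFDerivWithin_univ]

lemma contDiffOn_laplacianWithin_closure (hu : UniqueDiffOn ℝ (closure D))
    {g : EuclideanSpace ℝ (Fin n) → ℝ}
    (hg : ContDiffOn ℝ ((p + 2 : ℕ) : WithTop ℕ∞) g (closure D)) :
    ContDiffOn ℝ p (Δ[closure D] g) (closure D) := by
  have h : ContDiffOn ℝ p (fun x => ∑ i, iteratedFDerivWithin ℝ 2 g (closure D) x
      ![(stdOrthonormalBasis ℝ (EuclideanSpace ℝ (Fin n))) i,
        (stdOrthonormalBasis ℝ (EuclideanSpace ℝ (Fin n))) i]) (closure D) := by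
    refine ContDiffOn.sum fun i _ x hx => ?_
    have h1 := (hg x hx).iteratedFDerivWithin_right (m := p) (i := 2) hu (by norm_cast) hx
    exact (ContinuousMultilinearMap.apply ℝ (fun _ : Fin 2 => EuclideanSpace ℝ (Fin n)) ℝ
      _).contDiff.contDiffAt.comp_contDiffWithinAt x h1
  exact h.congr fun x hx =>
    InnerProductSpace.laplacianWithin_eq_iteratedFDerivWithin_stdOrthonormalBasis g hu hx

/-- A function on `closure D` that is smooth away from `ξ`, with the singularity cut out. -/
lemma contDiffOn_cutout {N : WithTop ℕ∞} (hN : N ≤ ∞) {ψ g : EuclideanSpace ℝ (Fin n) → ℝ}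
    (hψ : ContDiff ℝ ∞ ψ) (hψ1 : ∀ᶠ y in 𝓝 ξ, ψ y = 1)
    (hg : ContDiffOn ℝ N g (closure D \ {ξ})) :
    ContDiffOn ℝ N (fun y => (1 - ψ y) * g y) (closure D) := by
  intro x hx
  by_cases hxξ : x = ξ
  · subst hxξ
    refine ((contDiffAt_const (c := (0 : ℝ))).congr_of_eventuallyEq ?_).contDiffWithinAt
    filter_upwards [hψ1] with y hy
    rw [hy, sub_self, zero_mul]
  · refine ((contDiff_const.sub hψ).of_le hN).contDiffAt.contDiffWithinAt.mul ?_
    refine (hg x ⟨hx, hxξ⟩).mono_of_mem_nhdsWithin ?_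
    exact inter_mem_nhdsWithin _ (isOpen_compl_singleton.mem_nhds hxξ)

/-- A pair of cutoff functions near `ξ`: `ψ = 1` near `ξ`, and `χ = 1` near the support of `ψ`. -/
lemma exists_nested_cutoffs (hD : IsOpen D) (hξ : ξ ∈ D) :
    ∃ ψ χ : EuclideanSpace ℝ (Fin n) → ℝ, ContDiff ℝ ∞ ψ ∧ tsupport ψ ⊆ D ∧
      (∀ᶠ y in 𝓝 ξ, ψ y = 1) ∧ ContDiff ℝ ∞ χ ∧ HasCompactSupport χ ∧ tsupport χ ⊆ D ∧
      ∀ x ∈ tsupport ψ, ∀ᶠ y in 𝓝 x, χ y = 1 := by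
  obtain ⟨ψ, h1, h2, h3, h4⟩ := exists_contDiff_cutoff (isCompact_singleton (x := ξ)) hD
    (Set.singleton_subset_iff.2 hξ)
  obtain ⟨χ, g1, g2, g3, g4⟩ := exists_contDiff_cutoff h2.isCompact hD h3
  exact ⟨ψ, χ, h1, h3, h4 ξ rfl, g1, g2, g3, g4⟩

end LinearPDO

namespace LinearPDO

variable {n p : ℕ} {D : Set (EuclideanSpace ℝ (Fin n))} {L : LinearPDO D p}
  {u f : EuclideanSpace ℝ (Fin n) → ℝ}
  {t G : EuclideanSpace ℝ (Fin n) → EuclideanSpace ℝ (Fin n) → ℝ}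
  {ξ : EuclideanSpace ℝ (Fin n)}

lemma notMem_tsupport_of_mem_frontier (hD : IsOpen D) {ψ : EuclideanSpace ℝ (Fin n) → ℝ}
    (hψ : tsupport ψ ⊆ D) {s : EuclideanSpace ℝ (Fin n)} (hs : s ∈ frontier D) :
    s ∉ tsupport ψ := by
  rw [hD.frontier_eq] at hs
  exact fun h => hs.2 (hψ h)

lemma eventuallyEq_cutout {ψ g : EuclideanSpace ℝ (Fin n) → ℝ} {x : EuclideanSpace ℝ (Fin n)}
    (hx : x ∉ tsupport ψ) : (fun y => (1 - ψ y) * g y) =ᶠ[𝓝 x] g := by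
  filter_upwards [notMem_tsupport_iff_eventuallyEq.1 hx] with y hy
  simp [hy]

/-- The solution is recovered by pairing the right-hand side with the Laplacian of the generalized
Green's function. Near `ξ` this is `L Δ G(·, ξ) = δ_ξ`; away from `ξ` self-adjointness moves `L` to
`Δ G(·, ξ)`, which vanishes on the boundary and is annihilated by `L`. -/
theorem IsGeneralizedGreen.setIntegral_laplacian_mul (hG : L.IsGeneralizedGreen t G)
    (hL : L.IsSelfAdjoint) (hcomm : L.CommutesWithLaplacian) (hD : IsBoundedLipschitzDomain D)
    (hξ : ξ ∈ D) (hf : ContinuousOn f (closure D)) (hu : L.IsDirichletSolution f u) :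
    ∫ r in D, Δ (fun r => G r ξ) r * f r = u ξ := by
  have hDo := hD.isOpen
  have hDc := hD.isCompact_closure
  have hDu := hD.uniqueDiffOn_closure
  have hle : ∀ m : ℕ, (m : WithTop ℕ∞) ≤ ∞ := fun m => by exact_mod_cast le_top
  obtain ⟨ψ, χ, hψ, hψD, hψ1, hχ, hχc, hχD, hχ1⟩ := exists_nested_cutoffs hDo hξ
  have hξψ : ξ ∈ tsupport ψ := by
    refine subset_closure ?_
    rw [Function.mem_support, hψ1.self_of_nhds]
    exact one_ne_zero
  -- the part of `u` near `ξ`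
  have hχu : ContDiff ℝ p fun y => χ y * u y :=
    contDiff_mul_of_tsupport_subset (hχ.of_le (hle p)) hDo hχD (hu.contDiffOn.mono subset_closure)
  have h1 := hG.integral_laplacian_mul_apply_of_contDiff hL hcomm hDo hDc hξ hχu hχc.mul_right
    (tsupport_mul_subset_left.trans hχD)
  rw [(hχ1 ξ hξψ).self_of_nhds, one_mul] at h1
  -- the part of `u` away from `ξ`
  have hout : ContDiffOn ℝ p (fun y => (1 - χ y) * u y) (closure D) :=
    (((contDiff_const.sub hχ).of_le (hle p)).contDiffOn).mul hu.contDiffOn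
  have hout0 : ∀ x ∈ tsupport ψ, (fun y => (1 - χ y) * u y) =ᶠ[𝓝 x] fun _ => 0 := fun x hx => by
    filter_upwards [hχ1 x hx] with y hy
    rw [hy, sub_self, zero_mul]
  have hsplit : ∀ x ∈ D, L.apply (fun y => (1 - χ y) * u y) x =
      f x - L.apply (fun y => χ y * u y) x := by
    intro x hx
    have h2 : u = fun y => χ y * u y + (1 - χ y) * u y := by
      funext y; ring
    have h3 : L.apply u x = L.apply (fun y => χ y * u y) x +
        L.apply (fun y => (1 - χ y) * u y) x :=
      (congrArg (fun w => L.apply w x) h2).trans (apply_add hχu.contDiffAt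
        ((hout.mono subset_closure).contDiffAt (hDo.mem_nhds hx)))
    rw [← hu.equation x hx, h3, add_sub_cancel_left]
  -- a function of class `C^p` up to the boundary which equals `Δ G(·, ξ)` off the support of `ψ`,
  -- hence wherever `(1 - χ) u` does not vanish
  set Wc : EuclideanSpace ℝ (Fin n) → ℝ := Δ[closure D] fun y => (1 - ψ y) * G y ξ with hWc
  have hWcs : ContDiffOn ℝ p Wc (closure D) := contDiffOn_laplacianWithin_closure hDu
    (contDiffOn_cutout (hle (p + 2)) hψ hψ1 (hG.contDiffOn ξ hξ))
  have hWcW : ∀ x ∈ D, x ∉ tsupport ψ → Wc x = Δ (fun r => G r ξ) x := fun x hx hxψ => by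
    rw [hWc, laplacianWithin_closure_eq hDo hDu hx]
    exact (InnerProductSpace.laplacian_congr_nhds (eventuallyEq_cutout hxψ)).eq_of_nhds
  have hWc0 : ∀ x ∈ frontier D, Wc x = 0 := fun x hx => by
    have h2 := InnerProductSpace.laplacianWithin_congr_nhdsWithin (s := closure D) (x := x)
      ((eventuallyEq_cutout (g := fun y => G y ξ)
        (notMem_tsupport_of_mem_frontier hDo hψD hx)).filter_mono nhdsWithin_le_nhds) hDu
    rw [hWc, h2.eq_of_nhdsWithin (frontier_subset_closure hx)]
    exact hG.laplacian_boundary ξ hξ x hx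
  have h4 := hL Wc (fun y => (1 - χ y) * u y) hWcs hout hWc0
    (fun x hx => by rw [hu.boundary x hx, mul_zero])
  have h5 : ∫ x in D, L.apply Wc x * ((1 - χ x) * u x) = 0 := by
    refine setIntegral_eq_zero_of_forall_eq_zero fun x hx => ?_
    by_cases hxψ : x ∈ tsupport ψ
    · rw [(hout0 x hxψ).eq_of_nhds, mul_zero]
    · have hxξ : x ≠ ξ := fun h => hxψ (h ▸ hξψ)
      have h6 : Wc =ᶠ[𝓝 x] Δ (fun r => G r ξ) := by
        filter_upwards [hDo.mem_nhds hx, (isClosed_tsupport ψ).isOpen_compl.mem_nhds hxψ]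
          with y hy hyψ using hWcW y hy hyψ
      rw [apply_congr h6, hG.apply_laplacian_eq_zero hL hcomm hDo hξ x ⟨hx, hxξ⟩, zero_mul]
  have h7 : ∫ x in D, Wc x * L.apply (fun y => (1 - χ y) * u y) x =
      ∫ x in D, Δ (fun r => G r ξ) x * (f x - L.apply (fun y => χ y * u y) x) := by
    refine setIntegral_congr_fun hDo.measurableSet fun x hx => ?_
    simp only [← hsplit x hx]
    by_cases hxψ : x ∈ tsupport ψ
    · rw [apply_eq_zero_of_eventuallyEq_zero (hout0 x hxψ), mul_zero, mul_zero]
    · rw [hWcW x hx hxψ]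
  rw [h5, h7] at h4
  have hWi := hG.laplacian_integrableOn ξ hξ
  simp only [mul_sub] at h4
  rw [integral_sub (integrableOn_mul_continuousOn hDo hDc hWi hf)
    (integrableOn_mul_continuousOn hDo hDc hWi (continuousOn_closure_apply hχu)), h1] at h4
  linarith

lemma integrableOn_mul_laplacian (hD : IsBoundedLipschitzDomain D)
    {h : EuclideanSpace ℝ (Fin n) → ℝ} (hh : IntegrableOn h D) (hf : ContDiffOn ℝ 2 f (closure D)) :
    IntegrableOn (fun x => h x * Δ f x) D := by
  obtain ⟨F, hF, hFf⟩ := hD.exists_continuousOn_eq_laplacian hf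
  refine (integrableOn_mul_continuousOn hD.isOpen hD.isCompact_closure hh hF).congr_fun
    (fun x hx => ?_) hD.isOpen.measurableSet
  simp only [hFf x hx]

/-- Green's second identity for the singular function `G(·, ξ)`. There is no contribution from `ξ`,
because the distributional Laplacian of `G(·, ξ)` is the integrable function `Δ G(·, ξ)`. -/
theorem IsGeneralizedGreen.green (hG : L.IsGeneralizedGreen t G) (hD : IsBoundedLipschitzDomain D)
    (hξ : ξ ∈ D) (hf : ContDiffOn ℝ 2 f (closure D)) :
    Integrable (fun s => f s * normalDeriv D (fun r => G r ξ) s - G s ξ * normalDeriv D f s)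
      (surfaceMeasure D) ∧
    ∫ r in D, Δ (fun r => G r ξ) r * f r = (∫ r in D, G r ξ * Δ f r) +
      ∫ s, (f s * normalDeriv D (fun r => G r ξ) s - G s ξ * normalDeriv D f s)
        ∂(surfaceMeasure D) := by
  have hDo := hD.isOpen
  have hDc := hD.isCompact_closure
  obtain ⟨ψ, χ, hψ, hψD, hψ1, hχ, hχc, hχD, hχ1⟩ := exists_nested_cutoffs hDo hξ
  -- the singularity is cut out of both functions; since `1 - χ` vanishes on the support of `ψ`, the
  -- error on `D` only involves `χ f`, to which the distributional identity applies
  set g : EuclideanSpace ℝ (Fin n) → ℝ := fun y => (1 - ψ y) * G y ξ with hg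
  set h : EuclideanSpace ℝ (Fin n) → ℝ := fun y => (1 - χ y) * f y with hh
  have hgs : ContDiffOn ℝ 2 g (closure D) := contDiffOn_cutout (by norm_cast) hψ hψ1
    ((hG.contDiffOn ξ hξ).of_le (by norm_cast; exact Nat.le_add_left 2 p))
  have hhs : ContDiffOn ℝ 2 h (closure D) :=
    (((contDiff_const.sub hχ).of_le (by norm_cast)).contDiffOn).mul hf
  have hχf : ContDiff ℝ 2 fun y => χ y * f y :=
    contDiff_mul_of_tsupport_subset (hχ.of_le (by norm_cast)) hDo hχD (hf.mono subset_closure)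
  obtain ⟨h1, h2⟩ := hD.green hgs hhs
  have h3 := hG.weak_laplacian_of_contDiff hDo hDc hξ hχf hχc.mul_right
    (tsupport_mul_subset_left.trans hχD)
  have hsurf : (fun s => h s * normalDeriv D g s - g s * normalDeriv D h s) =ᵐ[surfaceMeasure D]
      fun s => f s * normalDeriv D (fun r => G r ξ) s - G s ξ * normalDeriv D f s := by
    filter_upwards [ae_restrict_mem isClosed_frontier.measurableSet] with s hs
    have e1 : g =ᶠ[𝓝 s] fun r => G r ξ :=
      eventuallyEq_cutout (notMem_tsupport_of_mem_frontier hDo hψD hs)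
    have e2 : h =ᶠ[𝓝 s] f :=
      eventuallyEq_cutout (notMem_tsupport_of_mem_frontier hDo hχD hs)
    simp only [normalDeriv]
    rw [e1.fderivWithin_eq_of_nhds, e2.fderivWithin_eq_of_nhds, e1.eq_of_nhds, e2.eq_of_nhds]
  have hWf := integrableOn_mul_continuousOn hDo hDc (hG.laplacian_integrableOn ξ hξ) hf.continuousOn
  have hGf := integrableOn_mul_laplacian hD (hG.integrableOn ξ hξ) hf
  have hWχ := integrableOn_mul_continuousOn hDo hDc (hG.laplacian_integrableOn ξ hξ)
    hχf.continuous.continuousOn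
  have hGχ := integrableOn_mul_continuousOn hDo hDc (hG.integrableOn ξ hξ)
    (continuous_laplacian hχf).continuousOn
  have hvol : ∀ x ∈ D, h x * Δ g x - g x * Δ h x =
      (Δ (fun r => G r ξ) x * f x - G x ξ * Δ f x) -
        (Δ (fun r => G r ξ) x * (χ x * f x) - G x ξ * Δ (fun y => χ y * f y) x) := by
    intro x hx
    have hat : ContDiffAt ℝ 2 h x := (hhs.mono subset_closure).contDiffAt (hDo.mem_nhds hx)
    have hsum : Δ f x = Δ (fun y => χ y * f y) x + Δ h x := by
      have e : f = (fun y => χ y * f y) + h := by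
        funext y
        simp only [hh, Pi.add_apply]
        ring
      conv_lhs => rw [e]
      exact hχf.contDiffAt.laplacian_add hat
    by_cases hxψ : x ∈ tsupport ψ
    · have e0 : h =ᶠ[𝓝 x] fun _ => 0 := by
        filter_upwards [hχ1 x hxψ] with y hy
        simp only [hh, hy, sub_self, zero_mul]
      have e1 : Δ h x = 0 := by
        rw [(InnerProductSpace.laplacian_congr_nhds e0).eq_of_nhds]
        simp
      rw [hsum, e1, e0.eq_of_nhds, (hχ1 x hxψ).self_of_nhds]
      ring
    · have e1 : g =ᶠ[𝓝 x] fun r => G r ξ := eventuallyEq_cutout hxψ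
      rw [(InnerProductSpace.laplacian_congr_nhds e1).eq_of_nhds, e1.eq_of_nhds, hsum]
      simp only [hh]
      ring
  have hWGf : IntegrableOn (fun x => Δ (fun r => G r ξ) x * f x - G x ξ * Δ f x) D := hWf.sub hGf
  have hWGχ : IntegrableOn (fun x => Δ (fun r => G r ξ) x * (χ x * f x) -
      G x ξ * Δ (fun y => χ y * f y) x) D := hWχ.sub hGχ
  rw [integral_congr_ae hsurf, setIntegral_congr_fun hDo.measurableSet hvol,
    integral_sub hWGf hWGχ, integral_sub hWf hGf, integral_sub hWχ hGχ, h3,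
    sub_self, sub_zero] at h2
  exact ⟨h1.congr hsurf, by linarith⟩

end LinearPDO

theorem mainTheorem1 {n p : ℕ} (hn : 1 ≤ n) {D : Set (EuclideanSpace ℝ (Fin n))}
    (hD : IsBoundedLipschitzDomain D)
    (L : LinearPDO D p) (hL : L.IsSelfAdjoint) (hcomm : L.CommutesWithLaplacian)
    (t G : EuclideanSpace ℝ (Fin n) → EuclideanSpace ℝ (Fin n) → ℝ)
    (hG : L.IsGeneralizedGreen t G)
    (f u : EuclideanSpace ℝ (Fin n) → ℝ) (hf : ContDiffOn ℝ 2 f (closure D))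
    (hu : L.IsDirichletSolution f u) :
    -- the representation formula, at every source point, with convergent integrals
    (∀ ξ ∈ D,
      IntegrableOn (fun r => G r ξ * Δ f r) D ∧
      Integrable (fun s => f s * normalDeriv D (fun r => G r ξ) s - G s ξ * normalDeriv D f s)
        (surfaceMeasure D) ∧
      u ξ = (∫ r in D, G r ξ * Δ f r) +
        ∫ s, (f s * normalDeriv D (fun r => G r ξ) s - G s ξ * normalDeriv D f s)
          ∂(surfaceMeasure D)) ∧
    -- its reduction when one factor of each boundary product vanishes
    (∀ ξ ∈ D,
      (∀ s ∈ frontier D, f s = 0 ∨ normalDeriv D (fun r => G r ξ) s = 0) →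
      (∀ s ∈ frontier D, G s ξ = 0 ∨ normalDeriv D f s = 0) →
      u ξ = ∫ r in D, G r ξ * Δ f r) ∧
    -- for a symmetric kernel, the same formulas with the two arguments exchanged
    ((∀ r ∈ D, ∀ ξ ∈ closure D, G r ξ = G ξ r) →
      (∀ r ∈ D,
        IntegrableOn (fun ξ => G r ξ * Δ f ξ) D ∧
        Integrable (fun s => f s * normalDeriv D (fun ξ => G r ξ) s - G r s * normalDeriv D f s)
          (surfaceMeasure D) ∧
        u r = (∫ ξ in D, G r ξ * Δ f ξ) +
          ∫ s, (f s * normalDeriv D (fun ξ => G r ξ) s - G r s * normalDeriv D f s)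
            ∂(surfaceMeasure D)) ∧
      (∀ r ∈ D,
        (∀ s ∈ frontier D, f s = 0 ∨ normalDeriv D (fun ξ => G r ξ) s = 0) →
        (∀ s ∈ frontier D, G r s = 0 ∨ normalDeriv D f s = 0) →
        u r = ∫ ξ in D, G r ξ * Δ f ξ)) := by
  have hrep : ∀ ξ ∈ D,
      IntegrableOn (fun r => G r ξ * Δ f r) D ∧
      Integrable (fun s => f s * normalDeriv D (fun r => G r ξ) s - G s ξ * normalDeriv D f s)
        (surfaceMeasure D) ∧
      u ξ = (∫ r in D, G r ξ * Δ f r) +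
        ∫ s, (f s * normalDeriv D (fun r => G r ξ) s - G s ξ * normalDeriv D f s)
          ∂(surfaceMeasure D) := fun ξ hξ => by
    obtain ⟨h1, h2⟩ := hG.green hD hξ hf
    exact ⟨LinearPDO.integrableOn_mul_laplacian hD (hG.integrableOn ξ hξ) hf, h1,
      (hG.setIntegral_laplacian_mul hL hcomm hD hξ hf.continuousOn hu).symm.trans h2⟩
  have hred : ∀ ξ ∈ D,
      (∀ s ∈ frontier D, f s = 0 ∨ normalDeriv D (fun r => G r ξ) s = 0) →
      (∀ s ∈ frontier D, G s ξ = 0 ∨ normalDeriv D f s = 0) →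
      u ξ = ∫ r in D, G r ξ * Δ f r := by
    intro ξ hξ h1 h2
    have h3 : ∫ s, (f s * normalDeriv D (fun r => G r ξ) s - G s ξ * normalDeriv D f s)
        ∂(surfaceMeasure D) = 0 :=
      setIntegral_eq_zero_of_forall_eq_zero fun s hs => by
        rw [mul_eq_zero.2 (h1 s hs), mul_eq_zero.2 (h2 s hs), sub_zero]
    rw [(hrep ξ hξ).2.2, h3, add_zero]
  refine ⟨hrep, hred, fun hsymm => ?_⟩
  -- symmetry for second arguments in the closed domain carries over to the normal derivative
  have hvol : ∀ r ∈ D, Set.EqOn (fun ξ => G ξ r * Δ f ξ) (fun ξ => G r ξ * Δ f ξ) D :=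
    fun r hr ξ hξ => by simp only [hsymm r hr ξ (subset_closure hξ)]
  have hnormal : ∀ r ∈ D, ∀ s ∈ frontier D,
      normalDeriv D (fun ξ => G r ξ) s = normalDeriv D (fun ξ => G ξ r) s := fun r hr s hs => by
    rw [normalDeriv, normalDeriv, fderivWithin_congr (fun ξ hξ => hsymm r hr ξ hξ)
      (hsymm r hr s (frontier_subset_closure hs))]
  have hsurf : ∀ r ∈ D,
      (fun s => f s * normalDeriv D (fun ξ => G ξ r) s - G s r * normalDeriv D f s)
        =ᵐ[surfaceMeasure D]
      fun s => f s * normalDeriv D (fun ξ => G r ξ) s - G r s * normalDeriv D f s := fun r hr => by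
    filter_upwards [ae_restrict_mem isClosed_frontier.measurableSet] with s hs
    rw [hnormal r hr s hs, hsymm r hr s (frontier_subset_closure hs)]
  refine ⟨fun r hr => ?_, fun r hr h1 h2 => ?_⟩
  · obtain ⟨h1, h2, h3⟩ := hrep r hr
    refine ⟨h1.congr_fun (hvol r hr) hD.isOpen.measurableSet, h2.congr (hsurf r hr), ?_⟩
    rw [h3, setIntegral_congr_fun hD.isOpen.measurableSet (hvol r hr),
      integral_congr_ae (hsurf r hr)]
  · rw [← setIntegral_congr_fun hD.isOpen.measurableSet (hvol r hr)]
    refine hred r hr (fun s hs => ?_) fun s hs => ?_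
    · rw [← hnormal r hr s hs]
      exact h1 s hs
    · rw [← hsymm r hr s (frontier_subset_closure hs)]
      exact h2 s hs
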